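/- Let $W(s)=\frac{(1-s^2)^2}{4}$, $S^1=\mathbb R/\mathbb Z$, and for $\epsilon>0$ let $E_\epsilon(u;I)=\int_I \frac{\epsilon}{2}|u'|^2+\frac1\epsilon W(u)$ be the Allen--Cahn energy. Fix an integer $p\ge 1$. There exists $\epsilon_p>0$ such that the following holds for every $0<\epsilon<\epsilon_p$. On $[0,\frac1{2p}]$ there is a unique positive minimizer $u^+$ of $E_\epsilon(\cdot\,;[0,\frac1{2p}])$ among all $W^{1,2}$ functions vanishing at both endpoints. Define $u=u_{\epsilon,2p}:S^1\to\mathbb R$ by $u(x)=(-1)^i u^+(x-\frac i{2p})$ for $x\in[\frac i{2p},\frac{i+1}{2p}]$, $i=0,\dots,2p-1$. Then $u$ solves $\epsilon^2u''=W'(u)$ on $S^1$, and: 1. The Allen--Cahn Morse index of $u$, i.e. the maximal dimension of a subspace of $W^{1,2}(S^1)$ on which $Q(\varphi)=\int_{S^1}\epsilon|\varphi'|^2+\frac1\epsilon W''(u)\varphi^2$ is negative definite, equals $2p-1$. 2. The Allen--Cahn nullity of $u$, i.e. the dimension of the kernel of $\epsilon^2\partial_x^2-W''(u)$ on $C^2(S^1)$,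 equals $1$, and this kernel is spanned by the infinitesimal rotation $\frac{d}{ds}\big|_{s=0}u(\cdot+s)=u'$. 3. For $f:\{0,\dots,2p-1\}\to\mathbb R$, extended $2p$-periodically to $\mathbb Z$, consider the moving nodes $a_i(t)=\frac i{2p}+t f(i)$. For $t$ near $0$ there is a function $U_t$ on $S^1$ vanishing at the nodes such that for each $i=0,\dots,2p-1$ the function $(-1)^iU_t$ is a positive energy minimizer on the arc $[a_i(t),a_{i+1}(t)]$ with zero Dirichlet data; for $t=0$ the function $u$ has this property. The balanced energy $\mathrm{BE}_\epsilon(t)=E_\epsilon(U_t;S^1)$ is $C^2$ near $t=0$ with $\mathrm{BE}_\epsilon'(0)=0$. If $f$ is constant (the variation is a rotation, or trivial), then $\mathrm{BE}_\epsilon''(0)=0$; for every other $f$, $\mathrm{BE}_\epsilon''(0)<0$. -/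

import Mathlib

namespace AllenCahn

open MeasureTheory

/-! Functions on the circle `S¹ = ℝ / ℤ` are treated as `1`-periodic functions on `ℝ`. -/

/-- The double-well potential `W(s) = (1 - s²)² / 4`. -/
noncomputable def doubleWell (s : ℝ) : ℝ := (1 - s ^ 2) ^ 2 / 4

/-- `φ ∈ W^{1,2}(a, b)`, for `φ` the absolutely continuous representative on `[a, b]`. -/
def IsH1On (a b : ℝ) (φ : ℝ → ℝ) : Prop :=
  AbsolutelyContinuousOnInterval φ a b ∧ MemLp (deriv φ) 2 (volume.restrict (Set.Ioc a b))

/-- `φ ∈ W^{1,2}(S¹)`. -/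
def IsH1Circle (φ : ℝ → ℝ) : Prop :=
  Function.Periodic φ 1 ∧ IsH1On 0 1 φ

/-- The Allen–Cahn energy `E_ε(u; [a, b]) = ∫_a^b (ε/2) |u'|² + W(u)/ε`. -/
noncomputable def energy (ε a b : ℝ) (u : ℝ → ℝ) : ℝ :=
  ∫ x in a..b, (ε / 2 * deriv u x ^ 2 + doubleWell (u x) / ε)

/-- `v` is a positive minimizer of `E_ε` on `[a, b]` among all functions in `W^{1,2}(a, b)` that
vanish at `a` and at `b`. The values of `v` outside `[a, b]` play no role. -/
def IsPositiveMinimizer (ε a b : ℝ) (v : ℝ → ℝ) : Prop :=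
  IsH1On a b v ∧ v a = 0 ∧ v b = 0 ∧ (∀ x ∈ Set.Ioo a b, 0 < v x) ∧
    ∀ w : ℝ → ℝ, IsH1On a b w → w a = 0 → w b = 0 → energy ε a b v ≤ energy ε a b w

/-- The function `u(x) = (-1)^i v(x mod 1/(2p))` for `x ∈ [i/(2p), (i+1)/(2p)]`. -/
noncomputable def dihedralExtension (p : ℕ) (v : ℝ → ℝ) (x : ℝ) : ℝ :=
  (-1 : ℝ) ^ ⌊2 * (p : ℝ) * x⌋ * v (x - ⌊2 * (p : ℝ) * x⌋ / (2 * (p : ℝ)))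

/-- `u : S¹ → ℝ` solves the Allen–Cahn equation `ε² u'' = W'(u)`. -/
def IsSolution (ε : ℝ) (u : ℝ → ℝ) : Prop :=
  Function.Periodic u 1 ∧ ContDiff ℝ 2 u ∧
    ∀ x, ε ^ 2 * iteratedDeriv 2 u x = deriv doubleWell (u x)

/-- The second variation
`Q(φ) = d²/dr² E_ε(u + r φ) |_{r = 0} = ∫_{S¹} ε |φ'|² + W''(u) φ² / ε`. -/
noncomputable def secondVariation (ε : ℝ) (u φ : ℝ → ℝ) : ℝ :=
  ∫ x in (0 : ℝ)..1,
    (ε * deriv φ x ^ 2 + iteratedDeriv 2 doubleWell (u x) / ε * φ x ^ 2)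

/-- The Allen–Cahn Morse index of `u`: the largest dimension of a finite-dimensional subspace of
`W^{1,2}(S¹)` on which the second variation of `E_ε` at `u` is negative definite. -/
noncomputable def morseIndex (ε : ℝ) (u : ℝ → ℝ) : ℕ∞ :=
  ⨆ (V : Submodule ℝ (ℝ → ℝ)) (_ : FiniteDimensional ℝ V ∧ (∀ φ ∈ V, IsH1Circle φ) ∧
    ∀ φ ∈ V, φ ≠ 0 → secondVariation ε u φ < 0), (Module.finrank ℝ V : ℕ∞)

/-- The kernel of `ε² ∂ₓ² - W''(u)` on `C²(S¹)`. -/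
def linearizedKernel (ε : ℝ) (u : ℝ → ℝ) : Submodule ℝ (ℝ → ℝ) where
  carrier := {φ | Function.Periodic φ 1 ∧ ContDiff ℝ 2 φ ∧
    ∀ x, ε ^ 2 * iteratedDeriv 2 φ x - iteratedDeriv 2 doubleWell (u x) * φ x = 0}
  zero_mem' := by
    refine ⟨fun x => rfl, contDiff_const, fun x => ?_⟩
    have h : iteratedDeriv 2 (0 : ℝ → ℝ) x = 0 := by
      simp
    simp [h]
  add_mem' := by
    rintro φ ψ ⟨h1, h2, h3⟩ ⟨k1, k2, k3⟩
    refine ⟨h1.add k1, h2.add k2, fun x => ?_⟩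
    rw [iteratedDeriv_add h2.contDiffAt k2.contDiffAt, Pi.add_apply]
    linear_combination h3 x + k3 x
  smul_mem' := by
    rintro c φ ⟨h1, h2, h3⟩
    refine ⟨fun x => by simp [h1 x], h2.const_smul c, fun x => ?_⟩
    rw [iteratedDeriv_const_smul h2.contDiffAt, Pi.smul_apply, smul_eq_mul, smul_eq_mul]
    linear_combination c * h3 x

/-- The Allen–Cahn nullity of `u`. -/
noncomputable def nullity (ε : ℝ) (u : ℝ → ℝ) : ℕ :=
  Module.finrank ℝ (linearizedKernel ε u)

/-- The variation of `u` that is generated by the rotations `x ↦ x + s` of the circle. -/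
noncomputable def rotationVariation (u : ℝ → ℝ) (x : ℝ) : ℝ :=
  deriv (fun s => u (x + s)) 0

/-- The moving nodes `a_i(t) = i/(2p) + t f(i/(2p))`, lifted to `ℝ`; `f` is a function on the
`2p` nodes, indexed by `ZMod (2 * p)`, so that `a_{2p}(t) = a_0(t) + 1`. -/
noncomputable def nodes (p : ℕ) (f : ZMod (2 * p) → ℝ) (t : ℝ) (i : ℕ) : ℝ :=
  (i : ℝ) / (2 * (p : ℝ)) + t * f (i : ZMod (2 * p))

/-- `U` is the broken `ε`-phase transition on the circle with the `2p` consecutive nodes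
`q 0 < q 1 < ⋯ < q (2p - 1) < q (2p) = q 0 + 1`: it is alternately a positive and minus a positive
energy minimizer, with zero Dirichlet data, on the arcs `[q i, q (i + 1)]`. -/
def IsBrokenPhaseTransition (ε : ℝ) (p : ℕ) (q : ℕ → ℝ) (U : ℝ → ℝ) : Prop :=
  Function.Periodic U 1 ∧ q (2 * p) = q 0 + 1 ∧
    ∀ i < 2 * p, q i < q (i + 1) ∧
      IsPositiveMinimizer ε (q i) (q (i + 1)) (fun x => (-1 : ℝ) ^ i * U x)

open Classical in
/-- The balanced energy `BE_ε(Y) = E_ε(U; S¹)` of the set `Y` of nodes `q 0, …, q (2p - 1)`, where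
`U` is a broken phase transition on `Y` (and `0` if there is none). -/
noncomputable def balancedEnergy (ε : ℝ) (p : ℕ) (q : ℕ → ℝ) : ℝ :=
  if h : ∃ U, IsBrokenPhaseTransition ε p q U then energy ε 0 1 h.choose else 0

end AllenCahn

namespace AllenCahn

open MeasureTheory Set Filter Topology Real
open scoped ContDiff

/-! ### The space `W^{1,2}` on an interval -/

/-! Everything is reduced to one family of explicit solutions. With amplitude `a ∈ (0, 1)` and `u =
a sin θ`, the first integral `ε² u'² = (a² - u²)(2 - a² - u²)/2` turns the equation into a
quadrature for the position `x(θ)`. The resulting `nodalSolution` changes sign under translation by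
`T = nodalLength ε a`, and every length above `2πε` occurs.

Minimality and uniqueness come together. `W` is quadratic in `s²`, so for a solution `v` vanishing
at both ends, `E(w) - E(v)` is exactly `(ε/2) ∫ w'² + V w²`, where `V = (v² - 1)/ε²`, plus a
multiple of `∫ (w² - v²)²` (`energy_eq_add_energy`). If `v > 0` inside, then, as `v'' = V v`,
Jacobi's factorization makes the quadratic form nonnegative (`dirichletForm_self_nonneg`).

For the second variation, `W''(u)/ε² = (u² - 1)/ε² + 2u²/ε²`, so the form is positive on nonzero
functions vanishing at all nodes. The derivative `u'` is orthogonal to every function, even arc by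
arc, because `u'' = 0` at the nodes; its nodal values alternate in sign. Hence `2p - 1` linear
conditions force nonnegativity, which bounds the index above. For the lower bound, glue combinations
of `u'` and `1 - u²` on the arcs: only the `1 - u²` part contributes, and its form is negative
(`dirichletForm_one_sub_sq_neg`). The same test functions show that a kernel element vanishing at
one node is zero, so the nullity is one.

For the balanced energy, `dE/da = (W(a)/ε) dT/da`, so the energy `e` of an arc as a function of its
length has `e' = W(a)/ε` and `e'' = W'(a)/(ε T'(a)) < 0`. The arc lengths vary as `1/(2p) + t δ i`
with `∑ δ i = 0`, hence `BE'(0) = 0` and `BE''(0) = e'' ∑ (δ i)²`. -/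

theorem intervalIntegral_congr_Ioo {a b : ℝ} (hab : a ≤ b) {f g : ℝ → ℝ}
    (h : ∀ x ∈ Ioo a b, f x = g x) : ∫ x in a..b, f x = ∫ x in a..b, g x := by
  rw [intervalIntegral.integral_of_le hab, intervalIntegral.integral_of_le hab,
    integral_Ioc_eq_integral_Ioo, integral_Ioc_eq_integral_Ioo]
  exact setIntegral_congr_fun measurableSet_Ioo h

/-- Only interior points are safe: at an end point `deriv` also sees values outside `[a, b]`. -/
theorem deriv_eq_of_eqOn_Icc {a b : ℝ} {f g : ℝ → ℝ} (h : EqOn f g (Icc a b)) {x : ℝ}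
    (hx : x ∈ Ioo a b) : deriv f x = deriv g x := by
  apply Filter.EventuallyEq.deriv_eq
  filter_upwards [Ioo_mem_nhds hx.1 hx.2] with y hy using h (Ioo_subset_Icc_self hy)

theorem _root_.AbsolutelyContinuousOnInterval.congr_of_eqOn {a b : ℝ} {f g : ℝ → ℝ}
    (hf : AbsolutelyContinuousOnInterval f a b) (h : EqOn f g (uIcc a b)) :
    AbsolutelyContinuousOnInterval g a b := by
  rw [absolutelyContinuousOnInterval_iff] at hf ⊢
  intro ε hε
  obtain ⟨δ, hδ, H⟩ := hf ε hε
  refine ⟨δ, hδ, fun E hE hlt => ?_⟩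
  have key := H E hE hlt
  rw [AbsolutelyContinuousOnInterval.disjWithin, mem_ofPred_eq] at hE
  rwa [Finset.sum_congr rfl fun i hi => by rw [← h (hE.1 i hi).1, ← h (hE.1 i hi).2]]

theorem _root_.ContDiff.absolutelyContinuousOnInterval {f : ℝ → ℝ} (hf : ContDiff ℝ 1 f)
    (a b : ℝ) : AbsolutelyContinuousOnInterval f a b :=
  hf.contDiffOn.absolutelyContinuousOnInterval

namespace IsH1On

variable {a b c d : ℝ} {φ ψ η : ℝ → ℝ}

theorem mono (h : IsH1On a b φ) (hac : a ≤ c) (hcd : c ≤ d) (hdb : d ≤ b) : IsH1On c d φ := by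
  refine ⟨h.1.mono ?_, h.2.mono_measure (Measure.restrict_mono (Ioc_subset_Ioc hac hdb) le_rfl)⟩
  rw [uIcc_of_le hcd, uIcc_of_le (hac.trans (hcd.trans hdb))]
  exact Icc_subset_Icc hac hdb

theorem congr (hab : a ≤ b) (h : IsH1On a b φ) (e : EqOn φ ψ (Icc a b)) : IsH1On a b ψ := by
  refine ⟨h.1.congr_of_eqOn (by rwa [uIcc_of_le hab]), ?_⟩
  rw [← restrict_Ioo_eq_restrict_Ioc]
  refine MemLp.ae_eq ?_ (restrict_Ioo_eq_restrict_Ioc (μ := volume) (a := a) (b := b) ▸ h.2)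
  filter_upwards [ae_restrict_mem measurableSet_Ioo] with x hx using deriv_eq_of_eqOn_Icc e hx

theorem ae_differentiableAt (hab : a ≤ b) (h : IsH1On a b φ) :
    ∀ᵐ x ∂(volume.restrict (Ioc a b)), DifferentiableAt ℝ φ x := by
  rw [ae_restrict_iff' measurableSet_Ioc]
  filter_upwards [h.1.ae_differentiableAt] with x hx hx2
  exact hx (by rw [uIcc_of_le hab]; exact Ioc_subset_Icc_self hx2)

theorem add (hab : a ≤ b) (h : IsH1On a b φ) (k : IsH1On a b ψ) : IsH1On a b (φ + ψ) := by
  refine ⟨h.1.add k.1, (h.2.add k.2).ae_eq ?_⟩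
  filter_upwards [h.ae_differentiableAt hab, k.ae_differentiableAt hab] with x h1 h2
  rw [Pi.add_apply, deriv_add h1 h2]

theorem smul (hab : a ≤ b) (r : ℝ) (h : IsH1On a b φ) : IsH1On a b (r • φ) := by
  refine ⟨h.1.const_mul r, (h.2.const_smul r).ae_eq ?_⟩
  filter_upwards [h.ae_differentiableAt hab] with x h1
  rw [Pi.smul_apply, deriv_const_smul _ h1]

theorem neg (hab : a ≤ b) (h : IsH1On a b φ) : IsH1On a b (-φ) := by
  simpa using h.smul hab (-1)

theorem sub (hab : a ≤ b) (h : IsH1On a b φ) (k : IsH1On a b ψ) : IsH1On a b (φ - ψ) := by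
  rw [sub_eq_add_neg]
  exact h.add hab (k.neg hab)

theorem continuousOn (hab : a ≤ b) (h : IsH1On a b φ) : ContinuousOn φ (Icc a b) := by
  simpa [uIcc_of_le hab] using h.1.continuousOn

theorem of_contDiff (hφ : ContDiff ℝ 1 φ) (a b : ℝ) : IsH1On a b φ := by
  refine ⟨hφ.absolutelyContinuousOnInterval a b, ?_⟩
  have hc : Continuous (deriv φ) := hφ.continuous_deriv le_rfl
  obtain ⟨C, hC⟩ := isCompact_Icc.exists_bound_of_continuousOn (s := Icc a b) hc.continuousOn
  refine MemLp.of_bound hc.aestronglyMeasurable C ?_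
  filter_upwards [ae_restrict_mem measurableSet_Ioc] with x hx using hC x (Ioc_subset_Icc_self hx)

theorem of_lipschitz {K : NNReal} (hφ : LipschitzWith K φ) (a b : ℝ) : IsH1On a b φ := by
  refine ⟨(hφ.lipschitzOnWith (s := uIcc a b)).absolutelyContinuousOnInterval, ?_⟩
  refine MemLp.of_bound (measurable_deriv φ).aestronglyMeasurable K ?_
  filter_upwards with x using norm_deriv_le_of_lipschitz hφ

theorem intervalIntegrable_deriv_mul (hab : a ≤ b) (h : IsH1On a b φ) (k : IsH1On a b ψ) :
    IntervalIntegrable (fun x => deriv φ x * deriv ψ x) volume a b := by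
  rw [intervalIntegrable_iff_integrableOn_Ioc_of_le hab]
  exact h.2.integrable_mul k.2

end IsH1On

/-! ### The bilinear form `∫ φ' ψ' + V φ ψ` -/

/-- The bilinear form `∫_a^b φ' ψ' + V φ ψ`. -/
noncomputable def dirichletForm (a b : ℝ) (V φ ψ : ℝ → ℝ) : ℝ :=
  ∫ x in a..b, (deriv φ x * deriv ψ x + V x * (φ x * ψ x))

section dirichletForm

variable {a b c d : ℝ} {V φ ψ η : ℝ → ℝ}

theorem dirichletForm_integrable (hab : a ≤ b) (hV : Continuous V) (h : IsH1On a b φ)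
    (k : IsH1On a b ψ) : IntervalIntegrable
      (fun x => deriv φ x * deriv ψ x + V x * (φ x * ψ x)) volume a b := by
  refine (h.intervalIntegrable_deriv_mul hab k).add (ContinuousOn.intervalIntegrable ?_)
  rw [uIcc_of_le hab]
  exact hV.continuousOn.mul ((h.continuousOn hab).mul (k.continuousOn hab))

theorem dirichletForm_comm : dirichletForm a b V φ ψ = dirichletForm a b V ψ φ := by
  unfold dirichletForm
  congr 1; ext x; ring

theorem dirichletForm_add_left (hab : a ≤ b) (hV : Continuous V) (h : IsH1On a b φ)
    (k : IsH1On a b ψ) (l : IsH1On a b η) :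
    dirichletForm a b V (φ + ψ) η = dirichletForm a b V φ η + dirichletForm a b V ψ η := by
  unfold dirichletForm
  rw [← intervalIntegral.integral_add (dirichletForm_integrable hab hV h l)
    (dirichletForm_integrable hab hV k l)]
  apply intervalIntegral.integral_congr_ae_restrict
  rw [uIoc_of_le hab]
  filter_upwards [h.ae_differentiableAt hab, k.ae_differentiableAt hab] with x h1 h2
  rw [deriv_add h1 h2, Pi.add_apply]
  ring

theorem dirichletForm_smul_left (hab : a ≤ b) (r : ℝ) (h : IsH1On a b φ) :
    dirichletForm a b V (r • φ) η = r * dirichletForm a b V φ η := by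
  unfold dirichletForm
  rw [← intervalIntegral.integral_const_mul]
  apply intervalIntegral.integral_congr_ae_restrict
  rw [uIoc_of_le hab]
  filter_upwards [h.ae_differentiableAt hab] with x h1
  rw [deriv_const_smul _ h1, Pi.smul_apply, smul_eq_mul, smul_eq_mul]
  ring

theorem dirichletForm_add_smul (hab : a ≤ b) (hV : Continuous V) (h : IsH1On a b φ)
    (k : IsH1On a b ψ) (r s : ℝ) :
    dirichletForm a b V (r • φ + s • ψ) (r • φ + s • ψ) = r ^ 2 * dirichletForm a b V φ φ +
      2 * r * s * dirichletForm a b V φ ψ + s ^ 2 * dirichletForm a b V ψ ψ := by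
  have h' := h.smul hab r
  have k' := k.smul hab s
  rw [dirichletForm_add_left hab hV h' k' (h'.add hab k'), dirichletForm_smul_left hab r h,
    dirichletForm_smul_left hab s k, dirichletForm_comm (φ := φ), dirichletForm_comm (φ := ψ),
    dirichletForm_add_left hab hV h' k' h, dirichletForm_add_left hab hV h' k' k,
    dirichletForm_smul_left hab r h, dirichletForm_smul_left hab r h,
    dirichletForm_smul_left hab s k, dirichletForm_smul_left hab s k,
    dirichletForm_comm (φ := ψ) (ψ := φ)]
  ring

theorem dirichletForm_congr (hab : a ≤ b) {φ' ψ' : ℝ → ℝ} (h : EqOn φ φ' (Icc a b))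
    (k : EqOn ψ ψ' (Icc a b)) : dirichletForm a b V φ ψ = dirichletForm a b V φ' ψ' := by
  refine intervalIntegral_congr_Ioo hab fun x hx => ?_
  rw [deriv_eq_of_eqOn_Icc h hx, deriv_eq_of_eqOn_Icc k hx, h (Ioo_subset_Icc_self hx),
    k (Ioo_subset_Icc_self hx)]

theorem dirichletForm_of_solution (hφ : ContDiff ℝ 2 φ)
    (hV : ∀ x, deriv (deriv φ) x = V x * φ x) (h : IsH1On a b ψ) :
    dirichletForm a b V φ ψ = deriv φ b * ψ b - deriv φ a * ψ a := by
  have hd : ContDiff ℝ 1 (deriv φ) := ((contDiff_succ_iff_deriv (n := 1)).1 hφ).2.2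
  rw [← (hd.absolutelyContinuousOnInterval a b).integral_deriv_mul_eq_sub h.1]
  unfold dirichletForm
  congr 1; ext x
  rw [hV]; ring

/-- The Dirichlet form is nonnegative on functions vanishing at the end points if the equation
`h'' = V h` has a solution which is positive in between. -/
theorem dirichletForm_self_nonneg (hab : a < b) (hV : Continuous V) (hφ : ContDiff ℝ 2 φ)
    (hφV : ∀ x, deriv (deriv φ) x = V x * φ x) (hpos : ∀ x ∈ Ioo a b, 0 < φ x)
    (h : IsH1On a b ψ) (ha : ψ a = 0) (hb : ψ b = 0) : 0 ≤ dirichletForm a b V ψ ψ := by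
  have hd : ContDiff ℝ 1 (deriv φ) := ((contDiff_succ_iff_deriv (n := 1)).1 hφ).2.2
  have hφ1 : ContDiff ℝ 1 φ := hφ.of_le (by norm_num)
  have hnn : ∀ x ∈ Icc a b, 0 ≤ φ x := by
    rw [← closure_Ioo hab.ne]
    exact closure_minimal (fun x hx => (hpos x hx).le) (isClosed_Ici.preimage hφ.continuous)
  have hψc := h.continuousOn hab.le
  have huI : uIoc a b = Ioc a b := uIoc_of_le hab.le
  have hbase := h.intervalIntegrable_deriv_mul hab.le h
  have hcont : ∀ η : ℝ, 0 < η →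
      ContinuousOn (fun x => V x * (φ x / (φ x + η)) * (ψ x * ψ x)) (Icc a b) := fun η hη =>
    (hV.continuousOn.mul (hφ.continuous.continuousOn.div
      (hφ.continuous.add continuous_const).continuousOn
        fun x hx => (add_pos_of_nonneg_of_pos (hnn x hx) hη).ne')).mul (hψc.mul hψc)
  have hint : ∀ η : ℝ, 0 < η → IntervalIntegrable
      (fun x => V x * (φ x / (φ x + η)) * (ψ x * ψ x)) volume a b := fun η hη => by
    apply ContinuousOn.intervalIntegrable
    rw [uIcc_of_le hab.le]
    exact hcont η hη
  -- Jacobi's trick: subtracting the derivative of `ψ² φ'/(φ + η)`, which integrates to zero, leaves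
  -- the square `(ψ' - ψ φ'/(φ + η))²`. The shift `η` is needed because `φ` may vanish at the end
  -- points.
  have key : ∀ η : ℝ, 0 < η →
      0 ≤ ∫ x in a..b, (deriv ψ x * deriv ψ x + V x * (φ x / (φ x + η)) * (ψ x * ψ x)) := by
    intro η hη
    have hne : ∀ x ∈ Icc a b, φ x + η ≠ 0 := fun x hx => by have := hnn x hx; positivity
    have hk : AbsolutelyContinuousOnInterval (fun x => deriv φ x / (φ x + η)) a b := by
      apply ContDiffOn.absolutelyContinuousOnInterval
      rw [uIcc_of_le hab.le]
      exact hd.contDiffOn.div (hφ1.contDiffOn.add contDiffOn_const) hne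
    have hAC := (h.1.fun_mul h.1).fun_mul hk
    have hz := hAC.integral_deriv_eq_sub
    rw [ha, hb] at hz
    simp only [mul_zero, zero_mul, sub_zero] at hz
    rw [← hz]
    refine intervalIntegral.integral_mono_ae_restrict hab.le hAC.intervalIntegrable_deriv
      (hbase.add (hint η hη)) ?_
    have hIcc : ∀ᵐ x ∂(volume.restrict (Icc a b)), DifferentiableAt ℝ ψ x := by
      rw [restrict_Ioc_eq_restrict_Icc.symm]
      exact h.ae_differentiableAt hab.le
    filter_upwards [hIcc, ae_restrict_mem measurableSet_Icc] with x h1 hx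
    have hne' := hne x hx
    have hder := (h1.hasDerivAt.mul h1.hasDerivAt).mul
      (((hd.differentiable (by norm_num) x).hasDerivAt).div
      ((hφ1.differentiable (by norm_num) x).hasDerivAt.add_const η) hne')
    have e : deriv (fun x => ψ x * ψ x * (deriv φ x / (φ x + η))) x = _ := hder.deriv
    rw [e, hφV]
    rw [← sub_nonneg]
    have : deriv ψ x * deriv ψ x + V x * (φ x / (φ x + η)) * (ψ x * ψ x) -
        ((deriv ψ x * ψ x + ψ x * deriv ψ x) * (deriv φ x / (φ x + η)) +
          ψ x * ψ x * ((V x * φ x * (φ x + η) - deriv φ x * deriv φ x) / (φ x + η) ^ 2)) =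
        (deriv ψ x - ψ x * (deriv φ x / (φ x + η))) ^ 2 := by
      field_simp; ring
    simp only [Pi.mul_apply, Pi.div_apply]
    rw [this]
    positivity
  -- Letting `η → 0`, the quotient `φ/(φ + η)` tends to `1` inside and is bounded by `1`; at `b` the
  -- factor `ψ b = 0` settles the limit.
  have hlim : Tendsto (fun n : ℕ => ∫ x in a..b, (deriv ψ x * deriv ψ x +
      V x * (φ x / (φ x + 1 / ((n : ℝ) + 1))) * (ψ x * ψ x))) atTop
      (𝓝 (dirichletForm a b V ψ ψ)) := by
    unfold dirichletForm
    have hη : ∀ n : ℕ, (0 : ℝ) < 1 / ((n : ℝ) + 1) := fun n => by positivity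
    refine intervalIntegral.tendsto_integral_filter_of_dominated_convergence
      (fun x => deriv ψ x * deriv ψ x + |V x| * (ψ x * ψ x)) ?_ ?_ ?_ ?_
    · refine Eventually.of_forall fun n => ?_
      exact (hbase.add (hint _ (hη n))).aestronglyMeasurable_restrict_uIoc
    · refine Eventually.of_forall fun n => Eventually.of_forall fun x hx => ?_
      rw [huI] at hx
      have hp := hnn x (Ioc_subset_Icc_self hx)
      have hq : |φ x / (φ x + 1 / ((n : ℝ) + 1))| ≤ 1 := by
        rw [abs_of_nonneg (by have := hη n; positivity), div_le_one (by have := hη n; positivity)]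
        have := hη n
        linarith
      refine (norm_add_le _ _).trans ?_
      rw [Real.norm_eq_abs, Real.norm_eq_abs, abs_mul_self, abs_mul, abs_mul, abs_mul_self]
      gcongr
      · exact mul_self_nonneg _
      · exact mul_le_of_le_one_right (abs_nonneg _) hq
    · refine hbase.add (ContinuousOn.intervalIntegrable ?_)
      rw [uIcc_of_le hab.le]
      exact (continuous_abs.comp hV).continuousOn.mul (hψc.mul hψc)
    · refine Eventually.of_forall fun x hx => ?_
      rw [huI] at hx
      rcases eq_or_lt_of_le hx.2 with rfl | hxb
      · simp [hb]
      have hp := hpos x ⟨hx.1, hxb⟩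
      have h1 : Tendsto (fun n : ℕ => φ x / (φ x + 1 / ((n : ℝ) + 1))) atTop (𝓝 1) := by
        have := (tendsto_const_nhds (x := φ x)).div
          ((tendsto_const_nhds (x := φ x)).add tendsto_one_div_add_atTop_nhds_zero_nat)
          (by simpa using hp.ne')
        rwa [add_zero, div_self hp.ne'] at this
      have := ((h1.const_mul (V x)).mul_const (ψ x * ψ x)).const_add (deriv ψ x * deriv ψ x)
      simpa using this
  exact ge_of_tendsto' hlim fun n => key _ (by positivity)

theorem dirichletForm_sum_arcs {q : ℕ → ℝ} {n : ℕ} (hq : ∀ i < n, q i ≤ q (i + 1))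
    (hV : Continuous V) (h : ∀ i < n, IsH1On (q i) (q (i + 1)) φ)
    (k : ∀ i < n, IsH1On (q i) (q (i + 1)) ψ) :
    dirichletForm (q 0) (q n) V φ ψ =
      ∑ i ∈ Finset.range n, dirichletForm (q i) (q (i + 1)) V φ ψ :=
  (intervalIntegral.sum_integral_adjacent_intervals fun i hi =>
    dirichletForm_integrable (hq i hi) hV (h i hi) (k i hi)).symm

end dirichletForm

/-! ### The equation `ε² u'' = W'(u)` on the line -/

/-- `u` is a solution of `ε² u'' = u³ - u` with amplitude `a` whose zeros are the
multiples of `T`. -/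
structure IsNodalSolution (ε a T : ℝ) (u : ℝ → ℝ) : Prop where
  contDiff : ContDiff ℝ ∞ u
  deriv_deriv : ∀ x, deriv (deriv u) x = (u x ^ 2 - 1) / ε ^ 2 * u x
  first_integral : ∀ x, ε ^ 2 * deriv u x ^ 2 = (a ^ 2 - u x ^ 2) * (2 - a ^ 2 - u x ^ 2) / 2
  apply_zero : u 0 = 0
  antiperiodic : ∀ x, u (x + T) = -u x
  pos : ∀ x ∈ Ioo 0 T, 0 < u x
  deriv_pos : 0 < deriv u 0
  length_pos : 0 < T
  sq_le : ∀ x, u x ^ 2 ≤ a ^ 2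

/-- The quantity `2 - a² - a² sin² θ`. -/
noncomputable def modulus (a θ : ℝ) : ℝ := 2 - a ^ 2 - a ^ 2 * sin θ ^ 2

theorem modulus_le {a : ℝ} (θ : ℝ) : modulus a θ ≤ 2 := by
  unfold modulus
  nlinarith [sq_nonneg a, mul_nonneg (sq_nonneg a) (sq_nonneg (sin θ))]

theorem le_modulus {a : ℝ} (θ : ℝ) : 2 - 2 * a ^ 2 ≤ modulus a θ := by
  unfold modulus
  nlinarith [sq_nonneg a, mul_nonneg (sq_nonneg a) (sq_nonneg (cos θ)), sin_sq_add_cos_sq θ]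

theorem modulus_pos {a : ℝ} (ha : a ∈ Ioo (0 : ℝ) 1) (θ : ℝ) : 0 < modulus a θ := by
  have := le_modulus (a := a) θ
  nlinarith [ha.1, ha.2]

theorem contDiff_modulus (a : ℝ) : ContDiff ℝ ∞ (modulus a) := by
  unfold modulus
  fun_prop

theorem hasDerivAt_modulus (a θ : ℝ) :
    HasDerivAt (modulus a) (-(a ^ 2 * (2 * sin θ * cos θ))) θ := by
  refine (((hasDerivAt_sin θ).pow 2).const_mul (a ^ 2)).const_sub (2 - a ^ 2) |>.congr_deriv ?_
  push_cast; ring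

/-- The speed `dx/dθ` of the parametrization of a nodal solution by its phase `θ`. -/
noncomputable def phaseRate (ε a θ : ℝ) : ℝ := √2 * ε / √(modulus a θ)

/-- The position `x` at which a nodal solution has the phase `θ`. -/
noncomputable def phasePosition (ε a θ : ℝ) : ℝ := ∫ t in (0 : ℝ)..θ, phaseRate ε a t

/-- The distance of two consecutive zeros of the nodal solution with amplitude `a`. -/
noncomputable def nodalLength (ε a : ℝ) : ℝ := phasePosition ε a π

/-- The nodal solution with amplitude `a`. -/
noncomputable def nodalSolution (ε a x : ℝ) : ℝ :=
  a * sin (Function.invFun (phasePosition ε a) x)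

section

variable {ε a : ℝ}

theorem contDiff_phaseRate (ha : a ∈ Ioo (0 : ℝ) 1) : ContDiff ℝ ∞ (phaseRate ε a) :=
  contDiff_const.div ((contDiff_modulus a).sqrt fun θ => (modulus_pos ha θ).ne')
    fun θ => (sqrt_pos.2 (modulus_pos ha θ)).ne'

theorem hasDerivAt_phasePosition (ha : a ∈ Ioo (0 : ℝ) 1) (θ : ℝ) :
    HasDerivAt (phasePosition ε a) (phaseRate ε a θ) θ :=
  (contDiff_phaseRate ha).continuous.integral_hasStrictDerivAt 0 θ |>.hasDerivAt

theorem le_phaseRate (hε : 0 < ε) (ha : a ∈ Ioo (0 : ℝ) 1) (θ : ℝ) : ε ≤ phaseRate ε a θ := by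
  unfold phaseRate
  rw [le_div_iff₀ (sqrt_pos.2 (modulus_pos ha θ)), mul_comm]
  gcongr
  exact modulus_le θ

theorem contDiff_phasePosition (ha : a ∈ Ioo (0 : ℝ) 1) : ContDiff ℝ ∞ (phasePosition ε a) := by
  rw [contDiff_infty_iff_deriv]
  refine ⟨fun θ => (hasDerivAt_phasePosition ha θ).differentiableAt, ?_⟩
  have : deriv (phasePosition ε a) = phaseRate ε a :=
    funext fun θ => (hasDerivAt_phasePosition ha θ).deriv
  rw [this]
  exact contDiff_phaseRate ha

theorem phasePosition_zero : phasePosition ε a 0 = 0 := by simp [phasePosition]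

/-- The rate involves only `sin² θ`, hence is `π`-periodic. As `sin` changes sign under `θ ↦ θ + π`,
this yields the antiperiodicity of the nodal solution. -/
theorem phasePosition_add_pi (ha : a ∈ Ioo (0 : ℝ) 1) (θ : ℝ) :
    phasePosition ε a (θ + π) = phasePosition ε a θ + nodalLength ε a := by
  have hc := (contDiff_phaseRate (ε := ε) ha).continuous
  have hper : Function.Periodic (phaseRate ε a) π := fun t => by
    simp [phaseRate, modulus, sin_add_pi]
  unfold nodalLength phasePosition
  rw [← intervalIntegral.integral_add_adjacent_intervals (hc.intervalIntegrable 0 θ)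
    (hc.intervalIntegrable θ (θ + π)), hper.intervalIntegral_add_eq θ 0, zero_add]

/-- The phase as a function of the position. -/
theorem exists_phase_homeomorph (hε : 0 < ε) (ha : a ∈ Ioo (0 : ℝ) 1) :
    ∃ e : ℝ ≃ₜ ℝ, (∀ θ, e θ = phasePosition ε a θ) ∧ ContDiff ℝ ∞ e.symm ∧
      StrictMono e.symm := by
  have hd := hasDerivAt_phasePosition (ε := ε) ha
  have hmono : StrictMono (phasePosition ε a) := strictMono_of_deriv_pos fun θ => by
    rw [(hd θ).deriv]; exact hε.trans_le (le_phaseRate hε ha θ)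
  -- The rate is at least `ε`, so the position grows at least linearly and is onto.
  have hmono' : Monotone fun θ => phasePosition ε a θ - ε * θ := by
    have hd' : ∀ θ, HasDerivAt (fun θ => phasePosition ε a θ - ε * θ)
        (phaseRate ε a θ - ε * 1) θ := fun θ => (hd θ).sub ((hasDerivAt_id θ).const_mul ε)
    refine monotone_of_deriv_nonneg (fun θ => (hd' θ).differentiableAt) fun θ => ?_
    rw [(hd' θ).deriv, mul_one, sub_nonneg]
    exact le_phaseRate hε ha θ
  have hsurj : Function.Surjective (phasePosition ε a) := by
    refine (contDiff_phasePosition ha).continuous.surjective ?_ ?_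
    · refine tendsto_atTop_mono' _ ?_ (tendsto_id.const_mul_atTop hε)
      filter_upwards [eventually_ge_atTop 0] with θ hθ
      have := hmono' hθ
      simp only [phasePosition_zero, mul_zero, sub_zero] at this
      simp only [id]; linarith
    · refine tendsto_atBot_mono' _ ?_ (tendsto_id.const_mul_atBot hε)
      filter_upwards [eventually_le_atBot 0] with θ hθ
      have := hmono' hθ
      simp only [phasePosition_zero, mul_zero, sub_zero] at this
      simp only [id]; linarith
  let o := hmono.orderIsoOfSurjective _ hsurj
  refine ⟨o.toHomeomorph, fun θ => rfl, ?_, o.symm.strictMono⟩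
  exact o.toHomeomorph.contDiff_symm_deriv (f' := phaseRate ε a)
    (fun θ => (hε.trans_le (le_phaseRate hε ha θ)).ne') (fun θ => hd θ)
    (contDiff_phasePosition ha)

theorem nodalSolution_phasePosition (hε : 0 < ε) (ha : a ∈ Ioo (0 : ℝ) 1) (θ : ℝ) :
    nodalSolution ε a (phasePosition ε a θ) = a * sin θ := by
  obtain ⟨e, he, -⟩ := exists_phase_homeomorph hε ha
  rw [nodalSolution, Function.leftInverse_invFun]
  intro x y h
  rw [← he, ← he] at h
  exact e.injective h

theorem nodalLength_pos (hε : 0 < ε) (ha : a ∈ Ioo (0 : ℝ) 1) : 0 < nodalLength ε a :=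
  intervalIntegral.intervalIntegral_pos_of_pos
    ((contDiff_phaseRate ha).continuous.intervalIntegrable _ _)
    (fun θ => hε.trans_le (le_phaseRate hε ha θ)) pi_pos

theorem contDiff_nodalSolution (hε : 0 < ε) (ha : a ∈ Ioo (0 : ℝ) 1) :
    ContDiff ℝ ∞ (nodalSolution ε a) := by
  obtain ⟨e, he, hsm, -⟩ := exists_phase_homeomorph hε ha
  have : nodalSolution ε a = fun x => a * sin (e.symm x) := by
    ext x
    conv_lhs => rw [← e.apply_symm_apply x, he]
    exact nodalSolution_phasePosition hε ha _
  rw [this]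
  exact contDiff_const.mul (contDiff_sin.comp hsm)

theorem deriv_nodalSolution_phasePosition (hε : 0 < ε) (ha : a ∈ Ioo (0 : ℝ) 1) (θ : ℝ) :
    deriv (nodalSolution ε a) (phasePosition ε a θ) =
      a * cos θ * √(modulus a θ) / (√2 * ε) := by
  have h1 := ((contDiff_nodalSolution hε ha).differentiable (by simp)
    (phasePosition ε a θ)).hasDerivAt.comp θ (hasDerivAt_phasePosition ha θ)
  have e : nodalSolution ε a ∘ phasePosition ε a = fun θ => a * sin θ :=
    funext (nodalSolution_phasePosition hε ha)
  rw [e] at h1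
  have h2 := h1.unique ((hasDerivAt_sin θ).const_mul a)
  have h3 := sqrt_pos.2 (modulus_pos ha θ)
  rw [← h2, phaseRate]
  field_simp

theorem deriv_deriv_nodalSolution_phasePosition (hε : 0 < ε) (ha : a ∈ Ioo (0 : ℝ) 1) (θ : ℝ) :
    deriv (deriv (nodalSolution ε a)) (phasePosition ε a θ) =
      ((a * sin θ) ^ 2 - 1) / ε ^ 2 * (a * sin θ) := by
  have hsm := contDiff_nodalSolution hε ha
  have hsm' : ContDiff ℝ ∞ (deriv (nodalSolution ε a)) := (contDiff_infty_iff_deriv.1 hsm).2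
  have h1 := (hsm'.differentiable (by simp)
    (phasePosition ε a θ)).hasDerivAt.comp θ (hasDerivAt_phasePosition ha θ)
  have e : deriv (nodalSolution ε a) ∘ phasePosition ε a =
      fun θ => a * cos θ * √(modulus a θ) / (√2 * ε) :=
    funext (deriv_nodalSolution_phasePosition hε ha)
  rw [e] at h1
  have hm := modulus_pos ha θ
  have h2 := h1.unique ((((hasDerivAt_cos θ).const_mul a).mul
    ((hasDerivAt_modulus a θ).sqrt hm.ne')).div_const (√2 * ε))
  have h3 := sqrt_pos.2 hm
  have h4 : √(modulus a θ) ^ 2 = modulus a θ := sq_sqrt hm.le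
  have h5 : √2 ^ 2 = (2 : ℝ) := sq_sqrt (by norm_num)
  have h6 : 0 < √(2 : ℝ) := by positivity
  rw [phaseRate] at h2
  field_simp at h2 ⊢
  rw [h5, h4] at h2
  have h7 : deriv (deriv (nodalSolution ε a)) (phasePosition ε a θ) * ε ^ 2 * 2 =
      a * sin θ * (a ^ 2 * sin θ ^ 2 - 1) * 2 := by
    rw [modulus] at h2
    linear_combination h2 + (-(sin θ * a ^ 3)) * sin_sq_add_cos_sq θ
  linarith

theorem isNodalSolution_nodalSolution (hε : 0 < ε) (ha : a ∈ Ioo (0 : ℝ) 1) :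
    IsNodalSolution ε a (nodalLength ε a) (nodalSolution ε a) := by
  obtain ⟨e, he, -, hmono⟩ := exists_phase_homeomorph hε ha
  have hsurj : ∀ x, ∃ θ, phasePosition ε a θ = x := fun x =>
    ⟨e.symm x, by rw [← he, e.apply_symm_apply]⟩
  have h5 : √2 ^ 2 = (2 : ℝ) := sq_sqrt (by norm_num)
  refine ⟨contDiff_nodalSolution hε ha, fun x => ?_, fun x => ?_, ?_, fun x => ?_,
    fun x hx => ?_, ?_, nodalLength_pos hε ha, fun x => ?_⟩
  · obtain ⟨θ, rfl⟩ := hsurj x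
    rw [deriv_deriv_nodalSolution_phasePosition hε ha, nodalSolution_phasePosition hε ha]
  · obtain ⟨θ, rfl⟩ := hsurj x
    rw [deriv_nodalSolution_phasePosition hε ha, nodalSolution_phasePosition hε ha, div_pow,
      mul_pow _ √(modulus a θ), sq_sqrt (modulus_pos ha θ).le, mul_pow _ ε, h5, modulus]
    field_simp
    linear_combination (a ^ 2 * (2 - a ^ 2 - a ^ 2 * sin θ ^ 2)) * sin_sq_add_cos_sq θ
  · have := nodalSolution_phasePosition hε ha 0
    rwa [phasePosition_zero, sin_zero, mul_zero] at this
  · obtain ⟨θ, rfl⟩ := hsurj x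
    rw [← phasePosition_add_pi ha, nodalSolution_phasePosition hε ha,
      nodalSolution_phasePosition hε ha, sin_add_pi]
    ring
  · obtain ⟨θ, rfl⟩ := hsurj x
    rw [nodalSolution_phasePosition hε ha]
    have h1 := hmono hx.1
    have h2 := hmono hx.2
    rw [← phasePosition_zero (ε := ε) (a := a), ← he, ← he, e.symm_apply_apply,
      e.symm_apply_apply] at h1
    rw [nodalLength, ← he, ← he, e.symm_apply_apply, e.symm_apply_apply] at h2
    exact mul_pos ha.1 (sin_pos_of_pos_of_lt_pi h1 h2)
  · have h := deriv_nodalSolution_phasePosition hε ha 0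
    rw [phasePosition_zero, cos_zero] at h
    have h3 := sqrt_pos.2 (modulus_pos ha 0)
    have := ha.1
    rw [h]
    positivity
  · obtain ⟨θ, rfl⟩ := hsurj x
    rw [nodalSolution_phasePosition hε ha, mul_pow]
    exact mul_le_of_le_one_right (sq_nonneg a) (sin_sq_le_one θ)

/-! ### The distance of the zeros as a function of the amplitude -/

/-- Differentiation under the integral sign, dominated by the maximum of `|F'|` on a compact
product. It serves both the length and the energy. -/
theorem hasDerivAt_intervalIntegral_param {F F' : ℝ → ℝ → ℝ} {s : Set ℝ} (hs : IsOpen s)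
    (α β : ℝ) (hF : ∀ x ∈ s, ∀ θ, HasDerivAt (fun x => F x θ) (F' x θ) x)
    (hFc : ∀ x ∈ s, Continuous (F x))
    (hF' : ContinuousOn (Function.uncurry F') (s ×ˢ univ)) {x₀ : ℝ} (hx₀ : x₀ ∈ s) :
    HasDerivAt (fun x => ∫ θ in α..β, F x θ) (∫ θ in α..β, F' x₀ θ) x₀ ∧
      ContinuousAt (fun x => ∫ θ in α..β, F' x θ) x₀ := by
  obtain ⟨r, hr, hrs⟩ := Metric.nhds_basis_closedBall.mem_iff.1 (hs.mem_nhds hx₀)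
  have hcomp : IsCompact (Metric.closedBall x₀ r ×ˢ uIcc α β) :=
    (isCompact_closedBall x₀ r).prod isCompact_uIcc
  obtain ⟨C, hC⟩ := hcomp.exists_bound_of_continuousOn
    (hF'.mono (prod_mono hrs (subset_univ _)))
  have hF'c : ∀ x ∈ s, Continuous (F' x) := fun x hx => by
    rw [← continuousOn_univ]
    exact hF'.comp (f := fun θ => (x, θ)) (by fun_prop) fun θ _ => ⟨hx, mem_univ _⟩
  have hball : Metric.closedBall x₀ r ∈ 𝓝 x₀ := Metric.closedBall_mem_nhds x₀ hr
  constructor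
  · refine (intervalIntegral.hasDerivAt_integral_of_dominated_loc_of_deriv_le
      (bound := fun _ => C) hball ?_ ((hFc x₀ hx₀).intervalIntegrable _ _)
      (hF'c x₀ hx₀).aestronglyMeasurable ?_ intervalIntegrable_const ?_).2
    · filter_upwards [hball] with x hx using (hFc x (hrs hx)).aestronglyMeasurable
    · refine Eventually.of_forall fun θ hθ x hx => hC (x, θ) ⟨hx, uIoc_subset_uIcc hθ⟩
    · exact Eventually.of_forall fun θ hθ x hx => hF x (hrs hx) θ
  · refine intervalIntegral.continuousAt_of_dominated_interval (bound := fun _ => C) ?_ ?_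
      intervalIntegrable_const ?_
    · filter_upwards [hball] with x hx using (hF'c x (hrs hx)).aestronglyMeasurable
    · filter_upwards [hball] with x hx
      exact Eventually.of_forall fun θ hθ => hC (x, θ) ⟨hx, uIoc_subset_uIcc hθ⟩
    · refine Eventually.of_forall fun θ hθ => ?_
      exact ((hF' (x₀, θ) ⟨hx₀, mem_univ _⟩).continuousAt
        ((hs.prod isOpen_univ).mem_nhds ⟨hx₀, mem_univ _⟩)).comp (f := fun x => (x, θ))
          (by fun_prop)

theorem hasDerivAt_modulus_left (a θ : ℝ) :
    HasDerivAt (fun a => modulus a θ) (-(2 * a * (1 + sin θ ^ 2))) a := by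
  have h := hasDerivAt_pow 2 a
  refine (h.const_sub 2).sub (h.mul_const (sin θ ^ 2)) |>.congr_deriv ?_
  push_cast; ring

/-- The derivative of `nodalLength ε` with respect to the amplitude. -/
noncomputable def nodalLengthDeriv (ε a : ℝ) : ℝ :=
  ∫ θ in (0 : ℝ)..π, √2 * ε * (a * (1 + sin θ ^ 2)) / (√(modulus a θ) * modulus a θ)

theorem continuous_uncurry_modulus : Continuous (Function.uncurry modulus) := by
  unfold modulus Function.uncurry
  fun_prop

theorem nodalLength_hasDerivAt (ha : a ∈ Ioo (0 : ℝ) 1) :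
    HasDerivAt (nodalLength ε) (nodalLengthDeriv ε a) a ∧
      ContinuousAt (nodalLengthDeriv ε) a := by
  refine hasDerivAt_intervalIntegral_param isOpen_Ioo 0 π (F := phaseRate ε)
    (F' := fun a θ => √2 * ε * (a * (1 + sin θ ^ 2)) / (√(modulus a θ) * modulus a θ))
    (fun x hx θ => ?_) (fun x hx => (contDiff_phaseRate hx).continuous) ?_ ha
  · have hm := modulus_pos hx θ
    have h3 := sqrt_pos.2 hm
    refine ((hasDerivAt_modulus_left x θ).sqrt hm.ne').fun_inv h3.ne' |>.const_mul (√2 * ε)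
      |>.congr_deriv ?_
    rw [sq_sqrt hm.le]
    field_simp
  · have hc := continuous_uncurry_modulus
    refine ContinuousOn.div (by fun_prop) ?_ fun x hx => ?_
    · exact (hc.sqrt.mul hc).continuousOn
    · have hm := modulus_pos hx.1 x.2
      have h3 := sqrt_pos.2 hm
      exact (mul_pos h3 hm).ne'

theorem nodalLengthDeriv_pos (hε : 0 < ε) (ha : a ∈ Ioo (0 : ℝ) 1) :
    0 < nodalLengthDeriv ε a := by
  refine intervalIntegral.intervalIntegral_pos_of_pos ?_ (fun θ => ?_) pi_pos
  · have hc := (contDiff_modulus a).continuous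
    refine (Continuous.div (by fun_prop) (hc.sqrt.mul hc) fun θ => ?_).intervalIntegrable _ _
    have hm := modulus_pos ha θ
    exact (mul_pos (sqrt_pos.2 hm) hm).ne'
  · have hm := modulus_pos ha θ
    have h3 := sqrt_pos.2 hm
    have := ha.1
    positivity

theorem nodalLength_le (hε : 0 < ε) {a : ℝ} (ha : a ∈ Ioo (0 : ℝ) 1) :
    nodalLength ε a ≤ ε * π / √(1 - a ^ 2) := by
  have h1 : 0 < 1 - a ^ 2 := by nlinarith [ha.1, ha.2]
  have h3 := sqrt_pos.2 h1
  have h2 : ∀ θ, phaseRate ε a θ ≤ ε / √(1 - a ^ 2) := fun θ => by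
    have h4 := sqrt_pos.2 (modulus_pos ha θ)
    rw [phaseRate, div_le_div_iff₀ h4 h3, mul_comm √2, mul_assoc, ← sqrt_mul (by norm_num)]
    gcongr
    have := le_modulus (a := a) θ
    linarith
  have := intervalIntegral.integral_mono_on pi_pos.le
    ((contDiff_phaseRate ha).continuous.intervalIntegrable _ _)
    (intervalIntegrable_const (μ := volume)) fun θ _ => h2 θ
  rw [intervalIntegral.integral_const, sub_zero, smul_eq_mul] at this
  calc nodalLength ε a ≤ π * (ε / √(1 - a ^ 2)) := this
    _ = _ := by ring

/-- For `a² = 1 - s²/2` the modulus is at most `cos² θ + s² ≤ (π/2 - θ + s)²` on `[0, π/2]`, so the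
length diverges logarithmically as `s → 0`, that is, as `a → 1`. -/
theorem log_le_nodalLength (hε : 0 < ε) {s : ℝ} (hs : s ∈ Ioo (0 : ℝ) 1) :
    -(ε * log s) ≤ nodalLength ε √(1 - s ^ 2 / 2) := by
  have hs2 : 0 < 1 - s ^ 2 / 2 := by nlinarith [hs.1, hs.2]
  have hs1 := hs.1
  have ha : √(1 - s ^ 2 / 2) ∈ Ioo (0 : ℝ) 1 :=
    ⟨sqrt_pos.2 hs2, by rw [sqrt_lt' one_pos]; nlinarith [hs.1]⟩
  have ha2 : √(1 - s ^ 2 / 2) ^ 2 = 1 - s ^ 2 / 2 := sq_sqrt hs2.le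
  set a := √(1 - s ^ 2 / 2)
  have hpi := pi_gt_three
  have hlow : ∀ θ ∈ Icc 0 (π / 2), ε * (π / 2 + s - θ)⁻¹ ≤ phaseRate ε a θ := by
    intro θ hθ
    have hm := modulus_pos ha θ
    have hp : 0 < π / 2 + s - θ := by linarith [hθ.2]
    have hle : √(modulus a θ) ≤ π / 2 + s - θ := by
      rw [sqrt_le_left hp.le, modulus, ha2]
      have hc : cos θ ≤ π / 2 - θ := by
        rw [← sin_pi_div_two_sub]
        exact sin_le (by linarith [hθ.2])
      have hc0 : 0 ≤ cos θ := cos_nonneg_of_mem_Icc ⟨by linarith [hθ.1], hθ.2⟩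
      nlinarith [sin_sq_add_cos_sq θ, mul_nonneg hs1.le (sub_nonneg.2 (hc0.trans hc)),
        sq_nonneg (s * cos θ)]
    rw [phaseRate, ← div_eq_mul_inv]
    have h2 : (1 : ℝ) ≤ √2 := by rw [one_le_sqrt]; norm_num
    have h3 := sqrt_pos.2 hm
    gcongr
    nlinarith
  have hint := (contDiff_phaseRate (ε := ε) ha).continuous
  have h1 : ∫ θ in (0 : ℝ)..π / 2, ε * (π / 2 + s - θ)⁻¹ = ε * log ((π / 2 + s) / s) := by
    rw [intervalIntegral.integral_const_mul,
      intervalIntegral.integral_comp_sub_left (fun x => x⁻¹) (π / 2 + s),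
      integral_inv_of_pos (by linarith) (by linarith)]
    congr 3 <;> ring
  have h2 : ε * log ((π / 2 + s) / s) ≤ ∫ θ in (0 : ℝ)..π / 2, phaseRate ε a θ := by
    rw [← h1]
    refine intervalIntegral.integral_mono_on (by linarith) ?_ (hint.intervalIntegrable _ _) hlow
    refine ContinuousOn.intervalIntegrable ?_
    rw [uIcc_of_le (by linarith)]
    refine continuousOn_const.mul (ContinuousOn.inv₀ (by fun_prop) fun θ hθ => ?_)
    have := hθ.2
    linarith
  have h3 : 0 ≤ ∫ θ in (π / 2)..π, phaseRate ε a θ :=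
    intervalIntegral.integral_nonneg (by linarith) fun θ _ =>
      (hε.trans_le (le_phaseRate hε ha θ)).le
  have h4 : nodalLength ε a = (∫ θ in (0 : ℝ)..π / 2, phaseRate ε a θ) +
      ∫ θ in (π / 2)..π, phaseRate ε a θ :=
    (intervalIntegral.integral_add_adjacent_intervals (hint.intervalIntegrable _ _)
      (hint.intervalIntegrable _ _)).symm
  have h5 : -log s ≤ log ((π / 2 + s) / s) := by
    rw [← log_inv]
    apply log_le_log (by positivity)
    rw [inv_eq_one_div]
    gcongr
    linarith
  nlinarith

/-- Every sufficiently large length is the distance of the zeros of a nodal solution. -/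
theorem exists_nodalLength_eq (hε : 0 < ε) {l : ℝ} (hl : 2 * π * ε < l) :
    ∃ a ∈ Ioo (0 : ℝ) 1, nodalLength ε a = l := by
  have hl0 : 0 < l := lt_trans (by positivity) hl
  -- The choice `s = exp (-l/ε)` makes the logarithmic lower bound equal to `l`; the amplitude `1/2`
  -- has length at most `2πε`. The intermediate value theorem does the rest.
  have hs : exp (-(l / ε)) ∈ Ioo (0 : ℝ) 1 :=
    ⟨exp_pos _, by rw [exp_lt_one_iff, neg_lt_zero]; positivity⟩
  have h1 := log_le_nodalLength hε hs
  rw [log_exp, mul_neg, neg_neg, mul_div_cancel₀ _ hε.ne'] at h1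
  have h2 := nodalLength_le hε (a := 1 / 2) (by norm_num)
  have h3 : ε * π / √(1 - (1 / 2) ^ 2) ≤ l := by
    have : (1 / 2 : ℝ) ≤ √(1 - (1 / 2) ^ 2) := by
      apply le_sqrt_of_sq_le; norm_num
    rw [div_le_iff₀ (by linarith)]
    nlinarith
  have hs2 : 0 < 1 - exp (-(l / ε)) ^ 2 / 2 := by nlinarith [hs.1, hs.2]
  have ha : √(1 - exp (-(l / ε)) ^ 2 / 2) ∈ Ioo (0 : ℝ) 1 :=
    ⟨sqrt_pos.2 hs2, by rw [sqrt_lt' one_pos]; nlinarith [hs.1]⟩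
  have hsub : uIcc (1 / 2) √(1 - exp (-(l / ε)) ^ 2 / 2) ⊆ Ioo (0 : ℝ) 1 :=
    (ordConnected_Ioo).uIcc_subset (by norm_num) ha
  have hcont : ContinuousOn (nodalLength ε) (uIcc (1 / 2) √(1 - exp (-(l / ε)) ^ 2 / 2)) :=
    fun x hx => (nodalLength_hasDerivAt (hsub hx)).1.continuousAt.continuousWithinAt
  obtain ⟨a, ha, rfl⟩ := intermediate_value_uIcc hcont
    (Icc_subset_uIcc ⟨h2.trans h3, h1⟩)
  exact ⟨a, hsub ha, rfl⟩

/-! ### The energy as a function of the amplitude -/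

/-- The energy of the nodal solution between two consecutive zeros. -/
noncomputable def nodalEnergy (ε a : ℝ) : ℝ := energy ε 0 (nodalLength ε a) (nodalSolution ε a)

/-- The first integral reads `W(u) - W(a) = ε² u'²/2`, so the energy density is `ε u'² + W(a)/ε`;
the first summand is then written in the phase variable. -/
theorem nodalEnergy_eq (hε : 0 < ε) (ha : a ∈ Ioo (0 : ℝ) 1) :
    nodalEnergy ε a = (∫ θ in (0 : ℝ)..π, a ^ 2 * cos θ ^ 2 * √(modulus a θ) / √2) +
      nodalLength ε a * doubleWell a / ε := by
  have hsm := contDiff_nodalSolution hε ha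
  have hc : Continuous fun x => ε / 2 * deriv (nodalSolution ε a) x ^ 2 +
      doubleWell (nodalSolution ε a x) / ε := by
    have h1 := hsm.continuous
    have h2 := hsm.continuous_deriv (by simp)
    unfold doubleWell
    fun_prop
  have hr := (contDiff_phaseRate (ε := ε) ha).continuous
  have h := intervalIntegral.integral_comp_mul_deriv (a := 0) (b := π)
    (fun θ _ => hasDerivAt_phasePosition (ε := ε) ha θ) hr.continuousOn hc
  rw [phasePosition_zero] at h
  rw [nodalEnergy, energy, nodalLength, ← h, phasePosition, mul_div_assoc, mul_comm _ (_ / ε),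
    ← intervalIntegral.integral_const_mul, ← intervalIntegral.integral_add]
  · refine intervalIntegral.integral_congr fun θ _ => ?_
    have hm := modulus_pos ha θ
    have h3 := sqrt_pos.2 hm
    have h5 : √2 ^ 2 = (2 : ℝ) := sq_sqrt (by norm_num)
    have h6 : 0 < √(2 : ℝ) := by positivity
    have h7 : √(modulus a θ) ^ 2 = modulus a θ := sq_sqrt hm.le
    simp only [Function.comp_apply]
    rw [deriv_nodalSolution_phasePosition hε ha, nodalSolution_phasePosition hε ha, phaseRate,
      doubleWell, doubleWell]
    field_simp
    rw [h7, h5, modulus]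
    linear_combination (-4 * a ^ 2 * (2 - a ^ 2 - a ^ 2 * sin θ ^ 2)) * sin_sq_add_cos_sq θ
  · have := (contDiff_modulus a).continuous
    exact Continuous.intervalIntegrable (by fun_prop) _ _
  · exact (hr.const_mul _).intervalIntegrable _ _

theorem nodalEnergy_hasDerivAt (hε : 0 < ε) (ha : a ∈ Ioo (0 : ℝ) 1) :
    HasDerivAt (nodalEnergy ε) (doubleWell a / ε * nodalLengthDeriv ε a) a := by
  have hS := (hasDerivAt_intervalIntegral_param isOpen_Ioo 0 π
    (F := fun a θ => a ^ 2 * cos θ ^ 2 * √(modulus a θ) / √2)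
    (F' := fun a θ => (2 * a * cos θ ^ 2 * √(modulus a θ) + a ^ 2 * cos θ ^ 2 *
      (-(2 * a * (1 + sin θ ^ 2)) / (2 * √(modulus a θ)))) / √2)
    (fun x hx θ => ?_) (fun x hx => ?_) ?_ ha).1
  · have hW : HasDerivAt doubleWell (a ^ 3 - a) a := by
      unfold doubleWell
      refine (((hasDerivAt_pow 2 a).const_sub 1).pow 2).div_const 4 |>.congr_deriv ?_
      push_cast; ring
    refine ((hS.add (((nodalLength_hasDerivAt (ε := ε) ha).1.mul hW).div_const
      ε)).congr_of_eventuallyEq ?_).congr_deriv ?_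
    · filter_upwards [Ioo_mem_nhds ha.1 ha.2] with x hx using nodalEnergy_eq hε hx
    · have hm := fun θ => modulus_pos ha θ
      -- The `a`-derivative of the kinetic integrand is `-W'(a)/ε` times the phase rate, up to the
      -- `θ`-derivative of this function, which vanishes at `0` and `π`. So the kinetic part cancels
      -- `T W'(a)/ε`.
      have hder : ∀ θ, HasDerivAt (fun θ => a * (sin θ * cos θ * √(modulus a θ)) / √2)
          (a * ((cos θ * cos θ + sin θ * -sin θ) * √(modulus a θ) + sin θ * cos θ *
            (-(a ^ 2 * (2 * sin θ * cos θ)) / (2 * √(modulus a θ)))) / √2) θ := fun θ =>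
        (((((hasDerivAt_sin θ).mul (hasDerivAt_cos θ)).mul
          ((hasDerivAt_modulus a θ).sqrt (hm θ).ne')).const_mul a).div_const √2)
      have hmc := (contDiff_modulus a).continuous
      have hs0 : ∀ θ, 2 * √(modulus a θ) ≠ 0 := fun θ => by
        have := sqrt_pos.2 (hm θ)
        positivity
      have hc : Continuous fun θ => a * ((cos θ * cos θ + sin θ * -sin θ) * √(modulus a θ) +
          sin θ * cos θ * (-(a ^ 2 * (2 * sin θ * cos θ)) / (2 * √(modulus a θ)))) / √2 := by
        fun_prop (disch := exact hs0 _)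
      have hint := intervalIntegral.integral_eq_sub_of_hasDerivAt (a := 0) (b := π)
        (fun θ _ => hder θ) (hc.intervalIntegrable _ _)
      simp only [sin_pi, sin_zero, zero_mul, mul_zero, zero_div, sub_zero] at hint
      have hsplit : ∫ θ in (0 : ℝ)..π, (2 * a * cos θ ^ 2 * √(modulus a θ) + a ^ 2 * cos θ ^ 2 *
          (-(2 * a * (1 + sin θ ^ 2)) / (2 * √(modulus a θ)))) / √2 =
          (∫ θ in (0 : ℝ)..π, a * ((cos θ * cos θ + sin θ * -sin θ) * √(modulus a θ) +
          sin θ * cos θ * (-(a ^ 2 * (2 * sin θ * cos θ)) / (2 * √(modulus a θ)))) / √2) +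
          (-(a ^ 3 - a) / ε) * nodalLength ε a := by
        rw [nodalLength, phasePosition, ← intervalIntegral.integral_const_mul,
          ← intervalIntegral.integral_add (hc.intervalIntegrable _ _)
          (((contDiff_phaseRate ha).continuous.const_mul _).intervalIntegrable _ _)]
        refine intervalIntegral.integral_congr fun θ _ => ?_
        have h3 := sqrt_pos.2 (hm θ)
        have h5 : √2 ^ 2 = (2 : ℝ) := sq_sqrt (by norm_num)
        have h6 : 0 < √(2 : ℝ) := by positivity
        have h7 : √(modulus a θ) ^ 2 = modulus a θ := sq_sqrt (hm θ).le
        have h8 : cos θ ^ 2 = 1 - sin θ ^ 2 := by linarith [sin_sq_add_cos_sq θ]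
        simp only [phaseRate]
        field_simp
        simp only [h7, h5, h8]
        unfold modulus
        ring
      rw [hsplit, hint]
      field_simp
      ring
  · refine ((((hasDerivAt_pow 2 x).mul_const (cos θ ^ 2)).mul
      ((hasDerivAt_modulus_left x θ).sqrt (modulus_pos hx θ).ne')).div_const √2).congr_deriv ?_
    push_cast; ring
  · have := (contDiff_modulus x).continuous
    fun_prop
  · have hc := continuous_uncurry_modulus
    have hc2 : ContinuousOn (fun x : ℝ × ℝ => √(modulus x.1 x.2)) (Ioo 0 1 ×ˢ univ) :=
      hc.sqrt.continuousOn
    have hs0 : ∀ x ∈ Ioo (0 : ℝ) 1 ×ˢ (univ : Set ℝ), 2 * √(modulus x.1 x.2) ≠ 0 := fun x hx => by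
      have := sqrt_pos.2 (modulus_pos hx.1 x.2)
      positivity
    refine ContinuousOn.div_const (ContinuousOn.add (ContinuousOn.mul (by fun_prop) hc2)
      (ContinuousOn.mul (by fun_prop) (ContinuousOn.div (by fun_prop)
        (continuousOn_const.mul hc2) hs0))) _

end

/-! ### Minimizers of the energy -/

theorem hasDerivAt_doubleWell (s : ℝ) : HasDerivAt doubleWell (s ^ 3 - s) s := by
  unfold doubleWell
  refine (((hasDerivAt_pow 2 s).const_sub 1).pow 2).div_const 4 |>.congr_deriv ?_
  push_cast; ring

theorem continuous_doubleWell : Continuous doubleWell := by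
  unfold doubleWell
  fun_prop

theorem energy_congr {ε a b : ℝ} (hab : a ≤ b) {v w : ℝ → ℝ} (h : EqOn v w (Icc a b)) :
    energy ε a b v = energy ε a b w :=
  intervalIntegral_congr_Ioo hab fun x hx => by
    rw [deriv_eq_of_eqOn_Icc h hx, h (Ioo_subset_Icc_self hx)]

theorem energy_density_neg_one_pow_mul (ε : ℝ) (i : ℕ) (v : ℝ → ℝ) (x : ℝ) :
    ε / 2 * deriv (fun x => (-1 : ℝ) ^ i * v x) x ^ 2 + doubleWell ((-1 : ℝ) ^ i * v x) / ε =
      ε / 2 * deriv v x ^ 2 + doubleWell (v x) / ε := by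
  have h : ((-1 : ℝ) ^ i) ^ 2 = 1 := by rw [← pow_mul, mul_comm, pow_mul]; norm_num
  rw [deriv_const_mul_field', doubleWell, doubleWell, mul_pow, mul_pow, h]
  ring

theorem IsH1On.energy_integrable {ε a b : ℝ} (hab : a ≤ b) {w : ℝ → ℝ} (h : IsH1On a b w) :
    IntervalIntegrable (fun x => ε / 2 * deriv w x ^ 2 + doubleWell (w x) / ε) volume a b := by
  refine IntervalIntegrable.add ?_ (ContinuousOn.intervalIntegrable ?_)
  · simp_rw [pow_two]
    exact (h.intervalIntegrable_deriv_mul hab h).const_mul _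
  · rw [uIcc_of_le hab]
    exact (continuous_doubleWell.comp_continuousOn (h.continuousOn hab)).div_const _

theorem IsPositiveMinimizer.congr {ε a b : ℝ} (hab : a ≤ b) {v w : ℝ → ℝ}
    (h : IsPositiveMinimizer ε a b v) (e : EqOn v w (Icc a b)) : IsPositiveMinimizer ε a b w := by
  obtain ⟨h1, h2, h3, h4, h5⟩ := h
  refine ⟨h1.congr hab e, ?_, ?_, fun x hx => ?_, fun z hz ha hb => ?_⟩
  · rw [← e (left_mem_Icc.2 hab), h2]
  · rw [← e (right_mem_Icc.2 hab), h3]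
  · rw [← e (Ioo_subset_Icc_self hx)]; exact h4 x hx
  · rw [← energy_congr hab e]; exact h5 z hz ha hb

section minimizer

variable {ε a b : ℝ} {v w : ℝ → ℝ}

/-- The expansion `W(w) = W(v) + (v² - 1)(w² - v²)/2 + (w² - v²)²/4` is exact, and the form with
potential `(v² - 1)/ε²` vanishes at `v` itself. -/
theorem energy_eq_add_energy (hε : 0 < ε) (hab : a ≤ b) (hv : ContDiff ℝ 2 v)
    (hode : ∀ x, deriv (deriv v) x = (v x ^ 2 - 1) / ε ^ 2 * v x) (hva : v a = 0) (hvb : v b = 0)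
    (hw : IsH1On a b w) :
    energy ε a b w = energy ε a b v +
      ε / 2 * dirichletForm a b (fun x => (v x ^ 2 - 1) / ε ^ 2) w w +
      1 / (4 * ε) * ∫ x in a..b, (w x ^ 2 - v x ^ 2) ^ 2 := by
  have hV : Continuous fun x => (v x ^ 2 - 1) / ε ^ 2 := by
    have := hv.continuous
    fun_prop
  have hvH : IsH1On a b v := .of_contDiff (hv.of_le (by norm_num)) a b
  have hwc := hw.continuousOn hab
  have hvv := dirichletForm_of_solution hv hode hvH
  rw [hva, hvb, mul_zero, mul_zero, sub_zero] at hvv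
  have h0 : energy ε a b v = energy ε a b v -
      ε / 2 * dirichletForm a b (fun x => (v x ^ 2 - 1) / ε ^ 2) v v := by rw [hvv]; ring
  rw [h0]
  unfold energy dirichletForm
  rw [← intervalIntegral.integral_const_mul, ← intervalIntegral.integral_const_mul,
    ← intervalIntegral.integral_const_mul, ← intervalIntegral.integral_sub
      (hvH.energy_integrable hab) ((dirichletForm_integrable hab hV hvH hvH).const_mul _),
    ← intervalIntegral.integral_add ((hvH.energy_integrable hab).sub
      ((dirichletForm_integrable hab hV hvH hvH).const_mul _))
      ((dirichletForm_integrable hab hV hw hw).const_mul _),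
    ← intervalIntegral.integral_add (((hvH.energy_integrable hab).sub
      ((dirichletForm_integrable hab hV hvH hvH).const_mul _)).add
      ((dirichletForm_integrable hab hV hw hw).const_mul _))]
  · congr 1; ext x
    unfold doubleWell
    field_simp
    ring
  · apply ContinuousOn.intervalIntegrable
    rw [uIcc_of_le hab]
    exact continuousOn_const.mul (((hwc.pow 2).sub (hv.continuous.continuousOn.pow 2)).pow 2)

/-- A solution of the Allen–Cahn equation which is positive between two of its zeros minimizes
the energy. -/
theorem isPositiveMinimizer_of_solution (hε : 0 < ε) (hab : a < b) (hv : ContDiff ℝ 2 v)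
    (hode : ∀ x, deriv (deriv v) x = (v x ^ 2 - 1) / ε ^ 2 * v x) (hva : v a = 0) (hvb : v b = 0)
    (hpos : ∀ x ∈ Ioo a b, 0 < v x) : IsPositiveMinimizer ε a b v := by
  refine ⟨.of_contDiff (hv.of_le (by norm_num)) a b, hva, hvb, hpos, fun w hw ha hb => ?_⟩
  rw [energy_eq_add_energy hε hab.le hv hode hva hvb hw]
  have hV : Continuous fun x => (v x ^ 2 - 1) / ε ^ 2 := by
    have := hv.continuous
    fun_prop
  have h1 := dirichletForm_self_nonneg hab hV hv hode hpos hw ha hb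
  have h2 : 0 ≤ ∫ x in a..b, (w x ^ 2 - v x ^ 2) ^ 2 :=
    intervalIntegral.integral_nonneg hab.le fun x _ => sq_nonneg _
  have h3 : 0 ≤ ε / 2 * dirichletForm a b (fun x => (v x ^ 2 - 1) / ε ^ 2) w w := by positivity
  have h4 : 0 ≤ 1 / (4 * ε) * ∫ x in a..b, (w x ^ 2 - v x ^ 2) ^ 2 := by positivity
  linarith

/-- Equality of energies kills the remainder `∫ (w² - v²)²`, and positivity turns `w² = v²` into `w
= v`. -/
theorem IsPositiveMinimizer.eqOn_solution (hε : 0 < ε) (hab : a < b) (hv : ContDiff ℝ 2 v)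
    (hode : ∀ x, deriv (deriv v) x = (v x ^ 2 - 1) / ε ^ 2 * v x) (hva : v a = 0) (hvb : v b = 0)
    (hpos : ∀ x ∈ Ioo a b, 0 < v x) (hw : IsPositiveMinimizer ε a b w) :
    EqOn w v (Icc a b) := by
  obtain ⟨h1, h2, h3, h4, h5⟩ := hw
  have hV : Continuous fun x => (v x ^ 2 - 1) / ε ^ 2 := by
    have := hv.continuous
    fun_prop
  have hle := h5 v (.of_contDiff (hv.of_le (by norm_num)) a b) hva hvb
  rw [energy_eq_add_energy hε hab.le hv hode hva hvb h1] at hle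
  have h6 := dirichletForm_self_nonneg hab hV hv hode hpos h1 h2 h3
  have h7 : 0 ≤ ε / 2 * dirichletForm a b (fun x => (v x ^ 2 - 1) / ε ^ 2) w w := by positivity
  have hcont : ContinuousOn (fun x => (w x ^ 2 - v x ^ 2) ^ 2) (Icc a b) :=
    (((h1.continuousOn hab.le).pow 2).sub (hv.continuous.continuousOn.pow 2)).pow 2
  intro x hx
  rcases eq_or_lt_of_le hx.1 with rfl | hxa
  · rw [h2, hva]
  rcases eq_or_lt_of_le hx.2 with rfl | hxb
  · rw [h3, hvb]
  by_contra hne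
  have hp := hpos x ⟨hxa, hxb⟩
  have hp' := h4 x ⟨hxa, hxb⟩
  have : 0 < ∫ x in a..b, (w x ^ 2 - v x ^ 2) ^ 2 := by
    refine intervalIntegral.integral_pos hab hcont (fun _ _ => sq_nonneg _) ⟨x, hx, ?_⟩
    have : w x ^ 2 - v x ^ 2 ≠ 0 := by
      rw [sq_sub_sq]
      exact mul_ne_zero (by positivity) (sub_ne_zero.2 hne)
    positivity
  have h8 : 0 < 1 / (4 * ε) * ∫ x in a..b, (w x ^ 2 - v x ^ 2) ^ 2 := by positivity
  linarith

end minimizer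

/-! ### Nodal solutions as solutions on the circle -/

namespace IsNodalSolution

variable {ε a T : ℝ} {u : ℝ → ℝ}

theorem apply_add_nat_mul (h : IsNodalSolution ε a T u) (n : ℕ) (x : ℝ) :
    u (x + n * T) = (-1) ^ n * u x := by
  induction n with
  | zero => simp
  | succ n ih =>
    rw [show x + (n + 1 : ℕ) * T = x + n * T + T by push_cast; ring, h.antiperiodic, ih]
    ring

theorem apply_nat_mul (h : IsNodalSolution ε a T u) (n : ℕ) : u (n * T) = 0 := by
  have := h.apply_add_nat_mul n 0
  rwa [zero_add, h.apply_zero, mul_zero] at this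

theorem apply_length (h : IsNodalSolution ε a T u) : u T = 0 := by
  simpa using h.apply_nat_mul 1

theorem contDiff_two (h : IsNodalSolution ε a T u) : ContDiff ℝ 2 u := contDiff_infty.1 h.contDiff 2

theorem isPositiveMinimizer_translate (h : IsNodalSolution ε a T u) (hε : 0 < ε) (q : ℝ) :
    IsPositiveMinimizer ε q (q + T) (fun x => u (x - q)) := by
  refine isPositiveMinimizer_of_solution hε (by linarith [h.length_pos])
    (h.contDiff_two.comp (contDiff_id.sub contDiff_const)) (fun x => ?_) ?_ ?_ fun x hx => ?_
  · have : deriv (fun x => u (x - q)) = fun x => deriv u (x - q) :=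
      funext fun x => deriv_comp_sub_const (f := u) ..
    rw [this, deriv_comp_sub_const (f := deriv u), h.deriv_deriv]
  · simp [h.apply_zero]
  · simp [h.apply_length]
  · exact h.pos _ ⟨by linarith [hx.1], by linarith [hx.2]⟩

theorem eqOn_of_isPositiveMinimizer (h : IsNodalSolution ε a T u) (hε : 0 < ε) {w : ℝ → ℝ}
    (hw : IsPositiveMinimizer ε 0 T w) : EqOn w u (Icc 0 T) :=
  hw.eqOn_solution hε h.length_pos h.contDiff_two h.deriv_deriv h.apply_zero h.apply_length h.pos

theorem energy_of_isPositiveMinimizer (h : IsNodalSolution ε a T u) (hε : 0 < ε) {q : ℝ}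
    {w : ℝ → ℝ} (hw : IsPositiveMinimizer ε q (q + T) w) :
    energy ε q (q + T) w = energy ε 0 T u := by
  have hu := h.isPositiveMinimizer_translate hε q
  have h1 := hw.2.2.2.2 _ hu.1 hu.2.1 hu.2.2.1
  have h2 := hu.2.2.2.2 _ hw.1 hw.2.1 hw.2.2.1
  rw [le_antisymm h1 h2, energy, energy]
  simp_rw [deriv_comp_sub_const (f := u)]
  rw [intervalIntegral.integral_comp_sub_right
    (fun x => ε / 2 * deriv u x ^ 2 + doubleWell (u x) / ε), sub_self, add_sub_cancel_left]

theorem periodic (h : IsNodalSolution ε a T u) {p : ℕ} (hT : 2 * p * T = 1) :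
    Function.Periodic u 1 := fun x => by
  have := h.apply_add_nat_mul (2 * p) x
  push_cast at this
  rwa [hT, pow_mul, neg_one_sq, one_pow, one_mul] at this

theorem apply_add_int_mul (h : IsNodalSolution ε a T u) (n : ℤ) (x : ℝ) :
    u (x + n * T) = (-1) ^ n * u x := by
  obtain ⟨m, rfl | rfl⟩ := n.eq_nat_or_neg
  · simpa using h.apply_add_nat_mul m x
  · have := h.apply_add_nat_mul m (x + (-(m : ℤ) : ℤ) * T)
    rw [show x + ((-(m : ℤ) : ℤ) : ℝ) * T + m * T = x by push_cast; ring] at this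
    rw [this, zpow_neg, zpow_natCast, ← mul_assoc,
      inv_mul_cancel₀ (pow_ne_zero _ (by norm_num)), one_mul]

/-- The glued function is the globally smooth nodal solution, so no matching of derivatives at the
nodes has to be checked. -/
theorem dihedralExtension_eq (h : IsNodalSolution ε a T u) {p : ℕ} (hp : 0 < p)
    (hT : T = 1 / (2 * (p : ℝ))) {v : ℝ → ℝ} (hv : EqOn v u (Icc 0 T)) :
    dihedralExtension p v = u := by
  have hp' : (0 : ℝ) < 2 * p := by positivity
  ext x
  rw [dihedralExtension]
  set n := ⌊2 * (p : ℝ) * x⌋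
  have h1 : (n : ℝ) ≤ 2 * p * x := Int.floor_le _
  have h2 : 2 * p * x < n + 1 := Int.lt_floor_add_one _
  have e : x - n / (2 * (p : ℝ)) = (2 * p * x - n) * T := by rw [hT]; field_simp
  have hm : x - n / (2 * (p : ℝ)) ∈ Icc 0 T := by
    rw [e]
    exact ⟨mul_nonneg (by linarith) h.length_pos.le,
      mul_le_of_le_one_left h.length_pos.le (by linarith)⟩
  rw [hv hm, ← h.apply_add_int_mul, hT]
  congr 1; ring

theorem isSolution (h : IsNodalSolution ε a T u) (hε : 0 < ε) {p : ℕ} (hT : 2 * p * T = 1) :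
    IsSolution ε u := by
  refine ⟨h.periodic hT, h.contDiff_two, fun x => ?_⟩
  rw [iteratedDeriv_succ, iteratedDeriv_one, h.deriv_deriv, (hasDerivAt_doubleWell _).deriv]
  field_simp

theorem isBrokenPhaseTransition (h : IsNodalSolution ε a T u) (hε : 0 < ε) {p : ℕ}
    (hT : 2 * p * T = 1) {q : ℕ → ℝ} (hq : ∀ i, q i = i * T) :
    IsBrokenPhaseTransition ε p q u := by
  refine ⟨h.periodic hT, ?_, fun i _ => ?_⟩
  · rw [hq, hq]; push_cast; linarith
  · have e : q (i + 1) = q i + T := by rw [hq, hq]; push_cast; ring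
    rw [e]
    refine ⟨by linarith [h.length_pos], ?_⟩
    have : (fun x => (-1 : ℝ) ^ i * u x) = fun x => u (x - q i) := by
      ext x
      have := h.apply_add_nat_mul i (x - q i)
      rw [hq, sub_add_cancel, ← hq] at this
      rw [this, ← mul_assoc, ← pow_add, ← two_mul, pow_mul, neg_one_sq, one_pow, one_mul]
    rw [this]
    exact h.isPositiveMinimizer_translate hε _

end IsNodalSolution

/-! ### Broken phase transitions -/

theorem nodes_le_nodes {n : ℕ} {q : ℕ → ℝ} (hq : ∀ i < n, q i < q (i + 1)) {i j : ℕ}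
    (hij : i ≤ j) (hj : j ≤ n) : q i ≤ q j := by
  induction j, hij using Nat.le_induction with
  | base => exact le_rfl
  | succ j _ ih => exact (ih (by omega)).trans (hq j (by omega)).le

theorem exists_isBrokenPhaseTransition {ε : ℝ} {p : ℕ} (hp : 0 < p) {q : ℕ → ℝ}
    (hq1 : q (2 * p) = q 0 + 1) (hq : ∀ i < 2 * p, q i < q (i + 1))
    (hmin : ∀ i < 2 * p, ∃ v, IsPositiveMinimizer ε (q i) (q (i + 1)) v) :
    ∃ U, IsBrokenPhaseTransition ε p q U := by
  choose! v hv using hmin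
  -- Half-open arcs put each point of `[q 0, q 0 + 1)` in exactly one summand.
  let g : ℝ → ℝ := fun y => ∑ i ∈ Finset.range (2 * p),
    (Ico (q i) (q (i + 1))).indicator (fun y => (-1 : ℝ) ^ i * v i y) y
  have hg : ∀ i < 2 * p, ∀ y ∈ Ico (q i) (q (i + 1)), g y = (-1 : ℝ) ^ i * v i y := by
    intro i hi y hy
    simp only [g]
    rw [Finset.sum_eq_single_of_mem i (Finset.mem_range.2 hi), indicator_of_mem hy]
    intro j hj hji
    rw [Finset.mem_range] at hj
    apply indicator_of_notMem
    rintro ⟨h1, h2⟩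
    rcases lt_or_gt_of_ne hji with hlt | hgt
    · linarith [hy.1, nodes_le_nodes hq (i := j + 1) (j := i) (by omega) (by omega)]
    · linarith [hy.2, nodes_le_nodes hq (i := i + 1) (j := j) (by omega) (by omega)]
  let U : ℝ → ℝ := fun x => g (q 0 + Int.fract (x - q 0))
  have hU : ∀ y ∈ Ico (q 0) (q (2 * p)), U y = g y := by
    intro y hy
    simp only [U]
    rw [Int.fract_eq_self.2 ⟨by linarith [hy.1], by linarith [hy.2]⟩, add_sub_cancel]
  have hper : Function.Periodic U 1 := fun x => by
    simp only [U]
    rw [show x + 1 - q 0 = x - q 0 + 1 by ring, Int.fract_add_one]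
  have hnode : ∀ i < 2 * p, U (q i) = 0 := fun i hi => by
    rw [hU _ ⟨nodes_le_nodes hq i.zero_le hi.le,
      (hq i hi).trans_le (nodes_le_nodes hq (by omega) le_rfl)⟩,
      hg i hi _ ⟨le_rfl, hq i hi⟩, (hv i hi).2.1, mul_zero]
  refine ⟨U, hper, hq1, fun i hi => ⟨hq i hi, (hv i hi).congr (hq i hi).le fun x hx => ?_⟩⟩
  -- The right end point belongs to the next arc, or to the first one by periodicity; the value is
  -- zero in either case.
  rcases eq_or_lt_of_le hx.2 with rfl | hlt
  · rw [(hv i hi).2.2.1]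
    rcases eq_or_lt_of_le (Nat.succ_le_of_lt hi) with he | hlt
    · rw [Nat.succ_eq_add_one] at he
      rw [he, hq1, hper, hnode 0 (by omega), mul_zero]
    · rw [hnode (i + 1) hlt, mul_zero]
  · have h0 := nodes_le_nodes hq i.zero_le hi.le
    have h1 := nodes_le_nodes hq (i := i + 1) (j := 2 * p) (by omega) le_rfl
    rw [hU x ⟨h0.trans hx.1, hlt.trans_le h1⟩, hg i hi x ⟨hx.1, hlt⟩, ← mul_assoc, ← pow_add,
      ← two_mul, pow_mul, neg_one_sq, one_pow, one_mul]

theorem IsBrokenPhaseTransition.energy_eq_sum {ε : ℝ} {p : ℕ} {q : ℕ → ℝ} {U : ℝ → ℝ}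
    (h : IsBrokenPhaseTransition ε p q U) : energy ε 0 1 U =
      ∑ i ∈ Finset.range (2 * p), energy ε (q i) (q (i + 1)) fun x => (-1 : ℝ) ^ i * U x := by
  obtain ⟨hper, hq1, harc⟩ := h
  have hper' : Function.Periodic (fun x => ε / 2 * deriv U x ^ 2 + doubleWell (U x) / ε) 1 :=
    fun x => by
      have : deriv U (x + 1) = deriv U x := by
        rw [← deriv_comp_add_const (f := U)]
        congr 1; exact funext hper
      simp only [this, hper x]
  have h1 := hper'.intervalIntegral_add_eq 0 (q 0)
  rw [zero_add, ← hq1] at h1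
  rw [energy, h1, ← intervalIntegral.sum_integral_adjacent_intervals (n := 2 * p)]
  · refine Finset.sum_congr rfl fun i _ => ?_
    rw [energy]
    simp_rw [energy_density_neg_one_pow_mul]
  · intro i hi
    have := (harc i hi).2.1.energy_integrable (ε := ε) (harc i hi).1.le
    simpa only [energy_density_neg_one_pow_mul] using this

/-- The broken transition chosen in `balancedEnergy` is arbitrary, but all minimizers on an arc have
the same energy, so the choice is harmless. -/
theorem balancedEnergy_eq_sum {ε : ℝ} (hε : 0 < ε) {p : ℕ} (hp : 0 < p) {q : ℕ → ℝ} {a : ℕ → ℝ}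
    (hq1 : q (2 * p) = q 0 + 1) (ha : ∀ i < 2 * p, a i ∈ Ioo (0 : ℝ) 1)
    (hq : ∀ i < 2 * p, q (i + 1) = q i + nodalLength ε (a i)) :
    (∃ U, IsBrokenPhaseTransition ε p q U) ∧
      balancedEnergy ε p q = ∑ i ∈ Finset.range (2 * p), nodalEnergy ε (a i) := by
  have hex : ∃ U, IsBrokenPhaseTransition ε p q U := by
    refine exists_isBrokenPhaseTransition hp hq1 (fun i hi => ?_) fun i hi => ?_
    · rw [hq i hi]; linarith [nodalLength_pos hε (ha i hi)]
    · rw [hq i hi]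
      exact ⟨_, (isNodalSolution_nodalSolution hε (ha i hi)).isPositiveMinimizer_translate hε _⟩
  refine ⟨hex, ?_⟩
  rw [balancedEnergy, dif_pos hex, hex.choose_spec.energy_eq_sum]
  refine Finset.sum_congr rfl fun i hi => ?_
  have hi := Finset.mem_range.1 hi
  have hmin := (hex.choose_spec.2.2 i hi).2
  rw [hq i hi] at hmin ⊢
  exact (isNodalSolution_nodalSolution hε (ha i hi)).energy_of_isPositiveMinimizer hε hmin

/-! ### The second variation -/

theorem iteratedDeriv_two_doubleWell (s : ℝ) : iteratedDeriv 2 doubleWell s = 3 * s ^ 2 - 1 := by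
  have h : deriv doubleWell = fun s => s ^ 3 - s := funext fun s => (hasDerivAt_doubleWell s).deriv
  rw [iteratedDeriv_succ, iteratedDeriv_one, h]
  have h2 : HasDerivAt (fun s : ℝ => s ^ 3 - s) (3 * s ^ 2 - 1) s :=
    ((hasDerivAt_pow 3 s).sub (hasDerivAt_id s)).congr_deriv (by push_cast; ring)
  exact h2.deriv

/-- The potential `W''(u) / ε²` of the linearized equation. -/
noncomputable def jacobiPotential (ε : ℝ) (u : ℝ → ℝ) (x : ℝ) : ℝ := (3 * u x ^ 2 - 1) / ε ^ 2

theorem secondVariation_eq {ε : ℝ} (hε : 0 < ε) (u φ : ℝ → ℝ) :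
    secondVariation ε u φ = ε * dirichletForm 0 1 (jacobiPotential ε u) φ φ := by
  unfold secondVariation dirichletForm jacobiPotential
  rw [← intervalIntegral.integral_const_mul]
  congr 1; ext x
  rw [iteratedDeriv_two_doubleWell]
  field_simp

theorem dirichletForm_sub_self {a b : ℝ} {V φ ψ : ℝ → ℝ} (hab : a ≤ b) (hV : Continuous V)
    (h : IsH1On a b φ) (k : IsH1On a b ψ) (h0 : dirichletForm a b V φ ψ = 0) (c : ℝ) :
    dirichletForm a b V (ψ - c • φ) (ψ - c • φ) =
      dirichletForm a b V ψ ψ + c ^ 2 * dirichletForm a b V φ φ := by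
  have := dirichletForm_add_smul hab hV k h 1 (-c)
  rw [one_smul, neg_smul, ← sub_eq_add_neg, dirichletForm_comm (φ := ψ) (ψ := φ), h0] at this
  rw [this]; ring

namespace IsNodalSolution

variable {ε a T : ℝ} {u : ℝ → ℝ}

theorem continuous_jacobiPotential (h : IsNodalSolution ε a T u) :
    Continuous (jacobiPotential ε u) := by
  have := h.contDiff.continuous
  unfold jacobiPotential
  fun_prop

theorem contDiff_deriv (h : IsNodalSolution ε a T u) : ContDiff ℝ ∞ (deriv u) :=
  (contDiff_infty_iff_deriv.1 h.contDiff).2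

theorem deriv_apply_nat_mul (h : IsNodalSolution ε a T u) (n : ℕ) :
    deriv u (n * T) = (-1) ^ n * deriv u 0 := by
  have e : (fun x => u (x + n * T)) = fun x => (-1) ^ n * u x := funext (h.apply_add_nat_mul n)
  have := congrFun (congrArg deriv e) 0
  rwa [deriv_comp_add_const (f := u), zero_add, deriv_const_mul_field'] at this

theorem deriv_deriv_apply_nat_mul (h : IsNodalSolution ε a T u) (n : ℕ) :
    deriv (deriv u) (n * T) = 0 := by
  rw [h.deriv_deriv, h.apply_nat_mul, mul_zero]

theorem deriv_deriv_deriv (h : IsNodalSolution ε a T u) (x : ℝ) :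
    deriv (deriv (deriv u)) x = jacobiPotential ε u x * deriv u x := by
  rw [funext h.deriv_deriv]
  have hu := (h.contDiff.differentiable (by simp) x).hasDerivAt
  have h2 := (((hu.pow 2).sub_const 1).div_const (ε ^ 2)).mul hu
  refine h2.deriv.trans ?_
  simp only [jacobiPotential, Pi.pow_apply]
  push_cast; ring

theorem nodes_mem_Icc (h : IsNodalSolution ε a T u) {p : ℕ} (hT : 2 * p * T = 1) {i : ℕ}
    (hi : i ≤ 2 * p) : (i : ℝ) * T ∈ Icc (0 : ℝ) 1 := by
  have hT0 := h.length_pos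
  refine ⟨by positivity, ?_⟩
  rw [← hT]
  gcongr
  exact_mod_cast hi

/-- After integration by parts only the boundary terms `u'' ψ` remain, and `u'' = 0` at nodes. No
boundary condition on `ψ` is needed. -/
theorem dirichletForm_deriv_left (h : IsNodalSolution ε a T u) (i j : ℕ) {ψ : ℝ → ℝ}
    (hψ : IsH1On (i * T) (j * T) ψ) :
    dirichletForm (i * T) (j * T) (jacobiPotential ε u) (deriv u) ψ = 0 := by
  rw [dirichletForm_of_solution (contDiff_infty.1 h.contDiff_deriv 2) h.deriv_deriv_deriv hψ,
    h.deriv_deriv_apply_nat_mul, h.deriv_deriv_apply_nat_mul]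
  ring

theorem dirichletForm_deriv_left_circle (h : IsNodalSolution ε a T u) {p : ℕ}
    (hT : 2 * p * T = 1) {ψ : ℝ → ℝ} (hψ : IsH1On 0 1 ψ) :
    dirichletForm 0 1 (jacobiPotential ε u) (deriv u) ψ = 0 := by
  have := h.dirichletForm_deriv_left 0 (2 * p) (ψ := ψ)
  push_cast at this
  rw [hT, zero_mul] at this
  exact this hψ

/-- The Jacobi potential is `(u² - 1)/ε² + 2u²/ε²`. The form of the first summand is nonnegative on
each arc, since `(-1)^i u` is a positive solution there. -/
theorem integral_sq_le_dirichletForm (h : IsNodalSolution ε a T u) {p : ℕ}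
    (hT : 2 * p * T = 1) {ψ : ℝ → ℝ} (hψ : IsH1On 0 1 ψ) (h0 : ∀ i ≤ 2 * p, ψ (i * T) = 0) :
    2 / ε ^ 2 * ∫ x in (0 : ℝ)..1, (u x * ψ x) ^ 2 ≤
      dirichletForm 0 1 (jacobiPotential ε u) ψ ψ := by
  have hV : Continuous fun x => (u x ^ 2 - 1) / ε ^ 2 := by
    have := h.contDiff.continuous
    fun_prop
  have hle : ∀ i : ℕ, (i : ℝ) * T ≤ ((i + 1 : ℕ) : ℝ) * T := fun i => by
    have := h.length_pos
    gcongr; omega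
  have hH : ∀ i < 2 * p, IsH1On (i * T) (((i + 1 : ℕ) : ℝ) * T) ψ := fun i hi =>
    hψ.mono (h.nodes_mem_Icc hT hi.le).1 (hle i) (h.nodes_mem_Icc hT (i := i + 1) hi).2
  have h1 : 0 ≤ dirichletForm 0 1 (fun x => (u x ^ 2 - 1) / ε ^ 2) ψ ψ := by
    have hsum := dirichletForm_sum_arcs (q := fun i => i * T) (n := 2 * p)
      (fun i _ => hle i) hV hH hH
    push_cast at hsum
    rw [hT, zero_mul] at hsum
    rw [hsum]
    refine Finset.sum_nonneg fun i hi => ?_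
    rw [Finset.mem_range] at hi
    have hlt : (i : ℝ) * T < ((i : ℝ) + 1) * T := by linarith [h.length_pos]
    have e : ∀ x, (-1 : ℝ) ^ i * u x = u (x - i * T) := fun x => by
      have := h.apply_add_nat_mul i (x - i * T)
      rw [sub_add_cancel] at this
      rw [this, ← mul_assoc, ← pow_add, ← two_mul, pow_mul, neg_one_sq, one_pow, one_mul]
    have hHi := hH i hi
    have h0i := h0 (i + 1) hi
    push_cast at hHi h0i
    refine dirichletForm_self_nonneg (φ := fun x => (-1 : ℝ) ^ i * u x) hlt hV
      (contDiff_const.mul h.contDiff_two) (fun x => ?_) (fun x hx => ?_) hHi (h0 i hi.le) h0i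
    · rw [deriv_const_mul_field', deriv_const_mul_field']
      simp only [h.deriv_deriv]
      ring
    · rw [e]
      exact h.pos _ ⟨by linarith [hx.1], by linarith [hx.2]⟩
  have hc : IntervalIntegrable (fun x => (u x * ψ x) ^ 2) volume 0 1 := by
    apply ContinuousOn.intervalIntegrable
    rw [uIcc_of_le zero_le_one]
    exact (h.contDiff.continuous.continuousOn.mul (hψ.continuousOn zero_le_one)).pow 2
  have h2 : dirichletForm 0 1 (jacobiPotential ε u) ψ ψ =
      dirichletForm 0 1 (fun x => (u x ^ 2 - 1) / ε ^ 2) ψ ψ +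
        2 / ε ^ 2 * ∫ x in (0 : ℝ)..1, (u x * ψ x) ^ 2 := by
    unfold dirichletForm
    rw [← intervalIntegral.integral_const_mul, ← intervalIntegral.integral_add
      (dirichletForm_integrable zero_le_one hV hψ hψ) (hc.const_mul _)]
    congr 1; ext x
    unfold jacobiPotential
    ring
  linarith

theorem dirichletForm_nonneg_of_nodes (h : IsNodalSolution ε a T u) (hε : 0 < ε) {p : ℕ}
    (hT : 2 * p * T = 1) {ψ : ℝ → ℝ} (hψ : IsH1On 0 1 ψ) (h0 : ∀ i ≤ 2 * p, ψ (i * T) = 0) :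
    0 ≤ dirichletForm 0 1 (jacobiPotential ε u) ψ ψ := by
  refine le_trans ?_ (h.integral_sq_le_dirichletForm hT hψ h0)
  have : 0 ≤ ∫ x in (0 : ℝ)..1, (u x * ψ x) ^ 2 :=
    intervalIntegral.integral_nonneg zero_le_one fun x _ => sq_nonneg _
  positivity

theorem exists_mem_arc (h : IsNodalSolution ε a T u) {p : ℕ} (hT : 2 * p * T = 1) {x : ℝ}
    (hx : x ∈ Ico (0 : ℝ) 1) : ∃ j < 2 * p, x ∈ Ico (j * T) ((j + 1) * T) := by
  have hT0 := h.length_pos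
  have h1 : 0 ≤ x / T := div_nonneg hx.1 hT0.le
  refine ⟨⌊x / T⌋₊, ?_, ?_, ?_⟩
  · rw [Nat.floor_lt h1, div_lt_iff₀ hT0]
    push_cast
    rw [hT]; exact hx.2
  · rw [← le_div_iff₀ hT0]; exact Nat.floor_le h1
  · rw [← div_lt_iff₀ hT0]; exact Nat.lt_floor_add_one _

theorem eqOn_zero_of_dirichletForm_nonpos (h : IsNodalSolution ε a T u) (hε : 0 < ε) {p : ℕ}
    (hT : 2 * p * T = 1) {ψ : ℝ → ℝ} (hψ : IsH1On 0 1 ψ) (h0 : ∀ i ≤ 2 * p, ψ (i * T) = 0)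
    (hQ : dirichletForm 0 1 (jacobiPotential ε u) ψ ψ ≤ 0) : ∀ x ∈ Ico (0 : ℝ) 1, ψ x = 0 := by
  intro x hx
  obtain ⟨j, hj, hxj⟩ := h.exists_mem_arc hT hx
  rcases eq_or_lt_of_le hxj.1 with rfl | hlt
  · exact h0 j hj.le
  by_contra hne
  have hux : u x ≠ 0 := by
    have h1 := h.pos (x - j * T) ⟨by linarith, by linarith [hxj.2]⟩
    have h2 := h.apply_add_nat_mul j (x - j * T)
    rw [sub_add_cancel] at h2
    rw [h2]
    exact mul_ne_zero (pow_ne_zero _ (by norm_num)) h1.ne'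
  have hpos : 0 < ∫ x in (0 : ℝ)..1, (u x * ψ x) ^ 2 :=
    intervalIntegral.integral_pos zero_lt_one
      ((h.contDiff.continuous.continuousOn.mul (hψ.continuousOn zero_le_one)).pow 2)
      (fun _ _ => sq_nonneg _) ⟨x, Ico_subset_Icc_self hx, by
        have := mul_ne_zero hux hne
        positivity⟩
  have := h.integral_sq_le_dirichletForm hT hψ h0
  have : 0 < 2 / ε ^ 2 * ∫ x in (0 : ℝ)..1, (u x * ψ x) ^ 2 := by positivity
  linarith

/-! ### Upper bound for the Morse index -/

/-- The nodal values of `u'` alternate too, so subtracting a multiple of `u'` makes `ψ` vanish at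
all nodes without changing the form. -/
theorem dirichletForm_nonneg_of_alternating (h : IsNodalSolution ε a T u) (hε : 0 < ε) {p : ℕ}
    (hT : 2 * p * T = 1) {ψ : ℝ → ℝ} (hψ : IsH1On 0 1 ψ)
    (h0 : ∀ i ≤ 2 * p, ψ (i * T) = (-1) ^ i * ψ 0) :
    0 ≤ dirichletForm 0 1 (jacobiPotential ε u) ψ ψ := by
  have hN : IsH1On 0 1 (deriv u) := .of_contDiff (contDiff_infty.1 h.contDiff_deriv 1) 0 1
  have h1 := dirichletForm_sub_self zero_le_one h.continuous_jacobiPotential hN hψ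
    (h.dirichletForm_deriv_left_circle hT hψ) (ψ 0 / deriv u 0)
  rw [h.dirichletForm_deriv_left_circle hT hN, mul_zero, add_zero] at h1
  rw [← h1]
  refine h.dirichletForm_nonneg_of_nodes hε hT (hψ.sub zero_le_one (hN.smul zero_le_one _))
    fun i hi => ?_
  have := h.deriv_pos
  rw [Pi.sub_apply, Pi.smul_apply, smul_eq_mul, h0 i hi, h.deriv_apply_nat_mul]
  field_simp
  ring

theorem morseIndex_le (h : IsNodalSolution ε a T u) (hε : 0 < ε) {p : ℕ}
    (hT : 2 * p * T = 1) : morseIndex ε u ≤ ((2 * p - 1 : ℕ) : ℕ∞) := by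
  refine iSup₂_le fun V hV => ?_
  obtain ⟨hfin, hH1, hneg⟩ := hV
  rw [Nat.cast_le]
  by_contra! hlt
  -- The kernel consists of functions with alternating nodal values. The relation across the last
  -- arc follows from periodicity because `2p` is even, so `2p - 1` conditions suffice.
  let L : V →ₗ[ℝ] (Fin (2 * p - 1) → ℝ) :=
    { toFun := fun φ k => φ.1 (k * T) + φ.1 (((k : ℕ) + 1 : ℕ) * T)
      map_add' := fun φ ψ => by
        ext k
        simp only [Submodule.coe_add, Pi.add_apply]
        ring
      map_smul' := fun c φ => by
        ext k
        simp only [Submodule.coe_smul, Pi.smul_apply, smul_eq_mul, RingHom.id_apply]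
        ring }
  have hker : LinearMap.ker L ≠ ⊥ := LinearMap.ker_ne_bot_of_finrank_lt (by simpa using hlt)
  obtain ⟨φ, hφ, hne⟩ := (Submodule.ne_bot_iff _).1 hker
  have hφ0 : φ.1 ≠ 0 := fun h => hne (Subtype.ext h)
  have hlast := (hH1 φ.1 φ.2).1 0
  have halt : ∀ i < 2 * p, φ.1 (i * T) = (-1) ^ i * φ.1 0 := by
    intro i
    induction i with
    | zero => simp
    | succ i ih =>
      intro hi
      have h1 := congrFun (LinearMap.mem_ker.1 hφ) ⟨i, by omega⟩
      have h2 : φ.1 (i * T) + φ.1 ((i + 1 : ℕ) * T) = 0 := h1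
      rw [ih (by omega)] at h2
      rw [pow_succ]
      linarith
  have := hneg φ.1 φ.2 hφ0
  rw [secondVariation_eq hε] at this
  have h2 := h.dirichletForm_nonneg_of_alternating hε hT (hH1 φ.1 φ.2).2 fun i hi => by
    rcases eq_or_lt_of_le hi with rfl | hi
    · push_cast
      rw [hT, pow_mul, neg_one_sq, one_pow, one_mul, ← hlast, zero_add]
    · exact halt i hi
  have h3 : 0 ≤ ε * dirichletForm 0 1 (jacobiPotential ε u) φ φ := by positivity
  linarith

/-! ### The second variation on an arc -/

theorem contDiff_one_sub_sq (h : IsNodalSolution ε a T u) : ContDiff ℝ ∞ fun x => 1 - u x ^ 2 :=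
  contDiff_const.sub (h.contDiff.pow 2)

/-- By the first integral, `w = 1 - u²` satisfies `-w'' + J w = -(1 - a²)²/ε²` with `J` the Jacobi
potential. Moreover `w' = 0` at the nodes, and `w > 0`. -/
theorem dirichletForm_one_sub_sq_neg (h : IsNodalSolution ε a T u) (hε : 0 < ε)
    (ha : a ∈ Ioo (0 : ℝ) 1) (j : ℕ) :
    dirichletForm (j * T) ((j + 1 : ℕ) * T) (jacobiPotential ε u) (fun x => 1 - u x ^ 2)
      (fun x => 1 - u x ^ 2) < 0 := by
  have hu := h.contDiff.continuous
  have ha2 : 0 < 1 - a ^ 2 := by nlinarith [ha.1, ha.2]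
  have hlt : (j : ℝ) * T < (j + 1 : ℕ) * T := by
    have := h.length_pos
    push_cast; linarith
  have hd : ∀ x, deriv (fun x => 1 - u x ^ 2) x = -(2 * u x * deriv u x) := fun x => by
    have hu := (h.contDiff.differentiable (by simp) x).hasDerivAt
    refine ((hu.pow 2).const_sub 1).deriv.trans ?_
    push_cast; ring
  have hdd : ∀ x, deriv (fun x => -(2 * u x * deriv u x)) x =
      -(2 * deriv u x * deriv u x + 2 * u x * ((u x ^ 2 - 1) / ε ^ 2 * u x)) := fun x => by
    have hu := (h.contDiff.differentiable (by simp) x).hasDerivAt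
    have hu' := (h.contDiff_deriv.differentiable (by simp) x).hasDerivAt
    rw [h.deriv_deriv] at hu'
    exact ((hu.const_mul 2).mul hu').neg.deriv
  have hK : ContDiff ℝ 1 fun x => 1 - u x ^ 2 := contDiff_infty.1 h.contDiff_one_sub_sq 1
  have hK' : ContDiff ℝ 1 fun x => -(2 * u x * deriv u x) :=
    ((contDiff_const.mul (contDiff_infty.1 h.contDiff 1)).mul
      (contDiff_infty.1 h.contDiff_deriv 1)).neg
  have hparts := (hK'.absolutelyContinuousOnInterval (j * T)
    ((j + 1 : ℕ) * T)).integral_deriv_mul_eq_sub (hK.absolutelyContinuousOnInterval _ _)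
  simp only [hd, hdd, h.apply_nat_mul, mul_zero, zero_mul, neg_zero, sub_zero] at hparts
  have hpos : 0 < ∫ x in (j * T)..((j + 1 : ℕ) * T), (1 - a ^ 2) ^ 2 / ε ^ 2 * (1 - u x ^ 2) :=
    intervalIntegral.intervalIntegral_pos_of_pos
      (Continuous.intervalIntegrable (by fun_prop) _ _)
      (fun x => by
        have := h.sq_le x
        have : 0 < 1 - u x ^ 2 := by linarith
        positivity) hlt
  have hu' := h.contDiff_deriv.continuous
  have hV := h.continuous_jacobiPotential
  have key : dirichletForm (j * T) ((j + 1 : ℕ) * T) (jacobiPotential ε u) (fun x => 1 - u x ^ 2)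
      (fun x => 1 - u x ^ 2) =
      -∫ x in (j * T)..((j + 1 : ℕ) * T), (1 - a ^ 2) ^ 2 / ε ^ 2 * (1 - u x ^ 2) := by
    rw [← sub_zero (dirichletForm _ _ _ _ _), ← hparts, dirichletForm]
    simp only [hd]
    rw [← intervalIntegral.integral_sub (Continuous.intervalIntegrable (by fun_prop) _ _)
      (Continuous.intervalIntegrable (by fun_prop) _ _), ← intervalIntegral.integral_neg]
    congr 1; ext x
    have hf := h.first_integral x
    have hf' : deriv u x ^ 2 = (a ^ 2 - u x ^ 2) * (2 - a ^ 2 - u x ^ 2) / (2 * ε ^ 2) := by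
      field_simp
      linarith
    unfold jacobiPotential
    have e : ∀ w : ℝ, deriv u x * deriv u x = w → -(2 * u x * deriv u x) * -(2 * u x * deriv u x) +
        (3 * u x ^ 2 - 1) / ε ^ 2 * ((1 - u x ^ 2) * (1 - u x ^ 2)) -
        (-(2 * deriv u x * deriv u x + 2 * u x * ((u x ^ 2 - 1) / ε ^ 2 * u x)) * (1 - u x ^ 2) +
        -(2 * u x * deriv u x) * -(2 * u x * deriv u x)) =
        (3 * u x ^ 2 - 1) / ε ^ 2 * ((1 - u x ^ 2) * (1 - u x ^ 2)) +
        (2 * w + 2 * u x * ((u x ^ 2 - 1) / ε ^ 2 * u x)) * (1 - u x ^ 2) := by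
      rintro w rfl
      ring
    rw [e _ ((pow_two _).symm.trans hf')]
    field_simp
    ring
  rw [key, neg_lt_zero]
  exact hpos

end IsNodalSolution

/-! ### Test functions for the lower bound of the Morse index -/

/-- The restriction of this function to the two arcs adjacent to the node `i * T` is a test
function; it vanishes at the other end points of these arcs. -/
noncomputable def hatProfile (u : ℝ → ℝ) (i : ℕ) (x : ℝ) : ℝ :=
  (deriv u x / deriv u 0 + (-1) ^ i * (1 - u x ^ 2)) / 2

/-- The test function which is supported on the two arcs adjacent to the node `i * T`. -/
noncomputable def hat (T : ℝ) (u : ℝ → ℝ) (i : ℕ) (x : ℝ) : ℝ :=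
  hatProfile u i (max ((i - 1) * T) (min ((i + 1) * T) (Int.fract x)))

/-- The test function with the value `(-1) ^ i * d i` at the node `i * T`. -/
noncomputable def nodalTest (p : ℕ) (T : ℝ) (u : ℝ → ℝ) (d : ℕ → ℝ) : ℝ → ℝ :=
  ∑ i ∈ Finset.Ico 1 (2 * p), d i • hat T u i

theorem IsH1Circle.add {φ ψ : ℝ → ℝ} (h : IsH1Circle φ) (k : IsH1Circle ψ) :
    IsH1Circle (φ + ψ) :=
  ⟨h.1.add k.1, h.2.add zero_le_one k.2⟩

theorem IsH1Circle.smul {φ : ℝ → ℝ} (c : ℝ) (h : IsH1Circle φ) : IsH1Circle (c • φ) :=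
  ⟨h.1.smul c, h.2.smul zero_le_one c⟩

theorem isH1Circle_zero : IsH1Circle 0 :=
  ⟨fun _ => rfl, .of_contDiff contDiff_const 0 1⟩

namespace IsNodalSolution

variable {ε a T : ℝ} {u : ℝ → ℝ}

theorem contDiff_hatProfile (h : IsNodalSolution ε a T u) (i : ℕ) :
    ContDiff ℝ ∞ (hatProfile u i) :=
  ((h.contDiff_deriv.div_const _).add (contDiff_const.mul h.contDiff_one_sub_sq)).div_const _

/-- At the node `j * T` the functions `u'/u'(0)` and `1 - u²` equal `(-1)^j` and `1`, so the profile
vanishes at nodes of the parity opposite to `i`. -/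
theorem hatProfile_apply_nat_mul (h : IsNodalSolution ε a T u) (i j : ℕ) :
    hatProfile u i (j * T) = ((-1) ^ j + (-1) ^ i) / 2 := by
  rw [hatProfile, h.apply_nat_mul, h.deriv_apply_nat_mul,
    mul_div_cancel_right₀ _ h.deriv_pos.ne']
  ring

theorem hatProfile_apply_right (h : IsNodalSolution ε a T u) (i : ℕ) :
    hatProfile u i ((i + 1) * T) = 0 := by
  have := h.hatProfile_apply_nat_mul i (i + 1)
  push_cast at this
  rw [this]; ring

theorem hatProfile_apply_left (h : IsNodalSolution ε a T u) {i : ℕ} (hi : 1 ≤ i) :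
    hatProfile u i ((i - 1) * T) = 0 := by
  obtain ⟨k, rfl⟩ := Nat.exists_eq_add_of_le' hi
  have := h.hatProfile_apply_nat_mul (k + 1) k
  push_cast
  rw [add_sub_cancel_right, this]; ring

/-- At `x = 1` the fractional part jumps to `0`, but the profile vanishes at both clamped points. -/
theorem hat_eq (h : IsNodalSolution ε a T u) {p : ℕ} (hT : 2 * p * T = 1) {i : ℕ} (hi : 1 ≤ i)
    (hi' : i < 2 * p) {x : ℝ} (hx : x ∈ Icc (0 : ℝ) 1) :
    hat T u i x = hatProfile u i (max ((i - 1) * T) (min ((i + 1) * T) x)) := by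
  have hT0 := h.length_pos
  rcases eq_or_lt_of_le hx.2 with rfl | hlt
  · have h1 : (1 : ℝ) ≤ i := by exact_mod_cast hi
    have h2 : (i : ℝ) + 1 ≤ 2 * p := by exact_mod_cast hi'
    have h3 : ((i : ℝ) + 1) * T ≤ 1 :=
      (mul_le_mul_of_nonneg_right h2 hT0.le).trans_eq hT
    have h4 : 0 ≤ ((i : ℝ) - 1) * T := mul_nonneg (by linarith) hT0.le
    have h5 : 0 ≤ ((i : ℝ) + 1) * T := by positivity
    rw [hat, Int.fract_one, min_eq_right h5, max_eq_left h4, h.hatProfile_apply_left hi,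
      min_eq_left h3, max_eq_right (by gcongr; linarith), h.hatProfile_apply_right]
  · rw [hat, Int.fract_eq_self.2 ⟨hx.1, hlt⟩]

theorem isH1Circle_hat (h : IsNodalSolution ε a T u) {p : ℕ} (hT : 2 * p * T = 1) {i : ℕ}
    (hi : 1 ≤ i) (hi' : i < 2 * p) : IsH1Circle (hat T u i) := by
  have hT0 := h.length_pos
  refine ⟨fun x => by rw [hat, Int.fract_add_one, hat], ?_⟩
  obtain ⟨K, hK⟩ := (contDiff_infty.1 (h.contDiff_hatProfile i) 1).contDiffOn.exists_lipschitzOnWith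
    (s := Icc (((i : ℝ) - 1) * T) ((i + 1) * T)) (by decide) (convex_Icc _ _) isCompact_Icc
  have hclamp : LipschitzWith 1 fun x : ℝ => max (((i : ℝ) - 1) * T) (min ((i + 1) * T) x) :=
    (LipschitzWith.id.const_min _).const_max _
  have hmaps : MapsTo (fun x : ℝ => max (((i : ℝ) - 1) * T) (min ((i + 1) * T) x)) univ
      (Icc (((i : ℝ) - 1) * T) ((i + 1) * T)) := fun x _ =>
    ⟨le_max_left _ _, max_le (by gcongr; linarith) (min_le_left _ _)⟩
  have := lipschitzOnWith_univ.1 (hK.comp hclamp.lipschitzOnWith hmaps)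
  exact (IsH1On.of_lipschitz this 0 1).congr zero_le_one fun x hx => (h.hat_eq hT hi hi' hx).symm

theorem hat_eq_on_arc (h : IsNodalSolution ε a T u) {p : ℕ} (hT : 2 * p * T = 1) {i j : ℕ}
    (hi : 1 ≤ i) (hi' : i < 2 * p) (hj : j < 2 * p) {x : ℝ}
    (hx : x ∈ Icc (j * T) ((j + 1 : ℕ) * T)) :
    hat T u i x = (if i = j then hatProfile u j x else 0) +
      if i = j + 1 then hatProfile u (j + 1) x else 0 := by
  have hT0 := h.length_pos
  have hx1 : x ∈ Icc (0 : ℝ) 1 := ⟨(h.nodes_mem_Icc hT hj.le).1.trans hx.1,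
    hx.2.trans (h.nodes_mem_Icc hT (i := j + 1) hj).2⟩
  obtain ⟨hxl, hxr⟩ := hx
  push_cast at hxr
  rw [h.hat_eq hT hi hi' hx1]
  rcases lt_trichotomy i j with hlt | rfl | hgt
  · rw [if_neg hlt.ne, if_neg (by omega), min_eq_left, max_eq_right (by gcongr; linarith),
      h.hatProfile_apply_right, add_zero]
    have : (i : ℝ) + 1 ≤ j := by exact_mod_cast hlt
    exact le_trans (by gcongr) hxl
  · rw [if_pos rfl, if_neg (by omega), min_eq_right hxr, max_eq_right, add_zero]
    exact le_trans (by gcongr; linarith) hxl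
  · rw [if_neg hgt.ne']
    rcases eq_or_lt_of_le (Nat.succ_le_of_lt hgt) with he | hlt
    · rw [Nat.succ_eq_add_one] at he
      subst he
      push_cast
      rw [if_pos rfl, min_eq_right (hxr.trans (by gcongr; linarith)), add_sub_cancel_right,
        max_eq_right hxl, zero_add]
    · rw [if_neg (by omega)]
      have h1 : (j : ℝ) + 1 ≤ i - 1 := by
        rw [le_sub_iff_add_le]
        exact_mod_cast hlt
      have h2 : x ≤ ((i : ℝ) - 1) * T := hxr.trans (by gcongr)
      rw [min_eq_right (h2.trans (by gcongr; linarith)), max_eq_left h2,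
        h.hatProfile_apply_left hi, add_zero]

theorem isH1Circle_nodalTest (h : IsNodalSolution ε a T u) {p : ℕ} (hT : 2 * p * T = 1)
    (d : ℕ → ℝ) : IsH1Circle (nodalTest p T u d) :=
  Finset.sum_induction _ IsH1Circle (fun _ _ h k => h.add k) isH1Circle_zero fun _ hi =>
    (h.isH1Circle_hat hT (Finset.mem_Ico.1 hi).1 (Finset.mem_Ico.1 hi).2).smul _

/-- Only the hats of the two end nodes live on an arc. The conditions at `0` and `2 * p` account for
the hats missing from the sum. -/
theorem nodalTest_eqOn_arc (h : IsNodalSolution ε a T u) {p : ℕ} (hT : 2 * p * T = 1)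
    {d : ℕ → ℝ} (hd0 : d 0 = 0) (hd1 : d (2 * p) = 0) {j : ℕ} (hj : j < 2 * p) :
    EqOn (nodalTest p T u d) (((d j + d (j + 1)) / (2 * deriv u 0)) • deriv u +
      ((-1) ^ j * (d j - d (j + 1)) / 2) • fun x => 1 - u x ^ 2)
      (Icc (j * T) ((j + 1 : ℕ) * T)) := by
  intro x hx
  have e : nodalTest p T u d x = ∑ i ∈ Finset.Ico 1 (2 * p),
      ((if i = j then d j * hatProfile u j x else 0) +
        if i = j + 1 then d (j + 1) * hatProfile u (j + 1) x else 0) := by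
    rw [nodalTest, Finset.sum_apply]
    refine Finset.sum_congr rfl fun i hi => ?_
    rw [Pi.smul_apply, smul_eq_mul, h.hat_eq_on_arc hT (Finset.mem_Ico.1 hi).1
      (Finset.mem_Ico.1 hi).2 hj hx, mul_add]
    congr 1 <;> split_ifs with hij <;> simp [hij]
  have h1 : (if j ∈ Finset.Ico 1 (2 * p) then d j * hatProfile u j x else 0) =
      d j * hatProfile u j x := by
    split_ifs with hm
    · rfl
    · rw [Finset.mem_Ico] at hm
      obtain rfl : j = 0 := by omega
      rw [hd0, zero_mul]
  have h2 : (if j + 1 ∈ Finset.Ico 1 (2 * p) then d (j + 1) * hatProfile u (j + 1) x else 0) =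
      d (j + 1) * hatProfile u (j + 1) x := by
    split_ifs with hm
    · rfl
    · rw [Finset.mem_Ico] at hm
      have : j + 1 = 2 * p := by omega
      rw [this, hd1, zero_mul]
  rw [e, Finset.sum_add_distrib, Finset.sum_ite_eq', Finset.sum_ite_eq', h1, h2]
  have := h.deriv_pos.ne'
  simp only [Pi.add_apply, Pi.smul_apply, smul_eq_mul, hatProfile]
  field_simp
  ring

theorem nodalTest_apply_nat_mul (h : IsNodalSolution ε a T u) {p : ℕ} (hp : 0 < p)
    (hT : 2 * p * T = 1) {d : ℕ → ℝ} (hd0 : d 0 = 0) (hd1 : d (2 * p) = 0) {j : ℕ}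
    (hj : j ≤ 2 * p) : nodalTest p T u d (j * T) = (-1) ^ j * d j := by
  have hlt : ∀ j < 2 * p, nodalTest p T u d (j * T) = (-1) ^ j * d j := by
    intro j hj
    have hT0 := h.length_pos
    rw [h.nodalTest_eqOn_arc hT hd0 hd1 hj ⟨le_rfl, by push_cast; gcongr; linarith⟩]
    have := h.deriv_pos.ne'
    simp only [Pi.add_apply, Pi.smul_apply, smul_eq_mul, h.apply_nat_mul, h.deriv_apply_nat_mul]
    field_simp
    ring
  rcases eq_or_lt_of_le hj with rfl | hj
  · have h1 := (h.isH1Circle_nodalTest hT d).1 0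
    have h2 := hlt 0 (by omega)
    rw [Nat.cast_zero, zero_mul, hd0, mul_zero] at h2
    push_cast
    rw [hT, hd1, mul_zero, ← h2, ← h1, zero_add]
  · exact hlt j hj

/-- On each arc the `u'` part is orthogonal to everything, so only the increments of `d` enter; a
form value of zero then forces `d` to be constant. -/
theorem dirichletForm_nodalTest (h : IsNodalSolution ε a T u) {p : ℕ} (hT : 2 * p * T = 1)
    {d : ℕ → ℝ} (hd0 : d 0 = 0) (hd1 : d (2 * p) = 0) :
    dirichletForm 0 1 (jacobiPotential ε u) (nodalTest p T u d) (nodalTest p T u d) =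
      ∑ j ∈ Finset.range (2 * p), ((-1) ^ j * (d j - d (j + 1)) / 2) ^ 2 *
        dirichletForm (j * T) ((j + 1 : ℕ) * T) (jacobiPotential ε u) (fun x => 1 - u x ^ 2)
          (fun x => 1 - u x ^ 2) := by
  have hV := h.continuous_jacobiPotential
  have hle : ∀ j : ℕ, (j : ℝ) * T ≤ (j + 1 : ℕ) * T := fun j => by
    have := h.length_pos
    gcongr; omega
  have hH : ∀ j < 2 * p, IsH1On (j * T) ((j + 1 : ℕ) * T) (nodalTest p T u d) := fun j hj =>
    (h.isH1Circle_nodalTest hT d).2.mono (h.nodes_mem_Icc hT hj.le).1 (hle j)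
      (h.nodes_mem_Icc hT (i := j + 1) hj).2
  have hsum := dirichletForm_sum_arcs (q := fun i => i * T) (n := 2 * p) (fun i _ => hle i) hV hH hH
  have e : ((2 * p : ℕ) : ℝ) * T = 1 := by push_cast; exact hT
  simp only [e, Nat.cast_zero, zero_mul] at hsum
  rw [hsum]
  refine Finset.sum_congr rfl fun j hj => ?_
  have hEq := h.nodalTest_eqOn_arc hT hd0 hd1 (Finset.mem_range.1 hj)
  have hN : IsH1On (j * T) ((j + 1 : ℕ) * T) (deriv u) :=
    .of_contDiff (contDiff_infty.1 h.contDiff_deriv 1) _ _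
  have hK : IsH1On (j * T) ((j + 1 : ℕ) * T) (fun x => 1 - u x ^ 2) :=
    .of_contDiff (contDiff_infty.1 h.contDiff_one_sub_sq 1) _ _
  rw [dirichletForm_congr (hle j) hEq hEq, dirichletForm_add_smul (hle j) hV hN hK,
    h.dirichletForm_deriv_left j (j + 1) hN, h.dirichletForm_deriv_left j (j + 1) hK]
  ring

theorem dirichletForm_nodalTest_nonpos (h : IsNodalSolution ε a T u) (hε : 0 < ε)
    (ha : a ∈ Ioo (0 : ℝ) 1) {p : ℕ} (hT : 2 * p * T = 1) {d : ℕ → ℝ} (hd0 : d 0 = 0)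
    (hd1 : d (2 * p) = 0) :
    dirichletForm 0 1 (jacobiPotential ε u) (nodalTest p T u d) (nodalTest p T u d) ≤ 0 ∧
      (dirichletForm 0 1 (jacobiPotential ε u) (nodalTest p T u d) (nodalTest p T u d) = 0 →
        ∀ j ≤ 2 * p, d j = 0) := by
  rw [h.dirichletForm_nodalTest hT hd0 hd1]
  have hterm : ∀ j ∈ Finset.range (2 * p), ((-1) ^ j * (d j - d (j + 1)) / 2) ^ 2 *
      dirichletForm (j * T) ((j + 1 : ℕ) * T) (jacobiPotential ε u) (fun x => 1 - u x ^ 2)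
        (fun x => 1 - u x ^ 2) ≤ 0 := fun j _ =>
    mul_nonpos_of_nonneg_of_nonpos (sq_nonneg _) (h.dirichletForm_one_sub_sq_neg hε ha j).le
  refine ⟨Finset.sum_nonpos hterm, fun h0 j => ?_⟩
  rw [Finset.sum_eq_zero_iff_of_nonpos hterm] at h0
  induction j with
  | zero => exact fun _ => hd0
  | succ j ih =>
    intro hj
    have h1 := h0 j (Finset.mem_range.2 hj)
    rw [mul_eq_zero, or_iff_left (h.dirichletForm_one_sub_sq_neg hε ha j).ne] at h1
    have h2 : d j - d (j + 1) = 0 := by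
      have h3 : ((-1 : ℝ) ^ j) ≠ 0 := pow_ne_zero _ (by norm_num)
      simpa [h3] using h1
    linarith [ih (by omega)]

/-! ### Morse index and nullity -/

theorem le_morseIndex (h : IsNodalSolution ε a T u) (hε : 0 < ε) (ha : a ∈ Ioo (0 : ℝ) 1) {p : ℕ}
    (hp : 0 < p) (hT : 2 * p * T = 1) : ((2 * p - 1 : ℕ) : ℕ∞) ≤ morseIndex ε u := by
  -- Coordinate `i - 1` belongs to the node `i`; the nodes `0` and `2 * p` get the value zero.
  let D : (Fin (2 * p - 1) → ℝ) → ℕ → ℝ := fun c i =>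
    if hi : 1 ≤ i ∧ i < 2 * p then c ⟨i - 1, by omega⟩ else 0
  have hD0 : ∀ c, D c 0 = 0 := fun c => dif_neg (by omega)
  have hD1 : ∀ c, D c (2 * p) = 0 := fun c => dif_neg (by omega)
  let Φ : (Fin (2 * p - 1) → ℝ) →ₗ[ℝ] (ℝ → ℝ) :=
    { toFun := fun c => nodalTest p T u (D c)
      map_add' := fun c c' => by
        simp only [nodalTest, ← Finset.sum_add_distrib, ← add_smul]
        refine Finset.sum_congr rfl fun i hi => ?_
        rw [Finset.mem_Ico] at hi
        simp [D, hi]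
      map_smul' := fun r c => by
        simp only [nodalTest, Finset.smul_sum, smul_smul, RingHom.id_apply]
        refine Finset.sum_congr rfl fun i hi => ?_
        rw [Finset.mem_Ico] at hi
        simp [D, hi] }
  have hzero : ∀ c, (∀ j ≤ 2 * p, D c j = 0) → c = 0 := fun c hc => by
    ext k
    have h1 := hc (k + 1) (by omega)
    simp only [D] at h1
    rw [dif_pos (by omega)] at h1
    exact h1
  have hinj : Function.Injective Φ := by
    rw [← LinearMap.ker_eq_bot, LinearMap.ker_eq_bot']
    intro c hc
    refine hzero c fun j hj => ?_
    have h1 := h.nodalTest_apply_nat_mul hp hT (hD0 c) (hD1 c) hj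
    have h2 : nodalTest p T u (D c) = 0 := hc
    rw [h2, Pi.zero_apply] at h1
    exact (mul_eq_zero.1 h1.symm).resolve_left (pow_ne_zero _ (by norm_num))
  refine le_trans ?_ (le_iSup₂_of_le (LinearMap.range Φ) ⟨inferInstance, ?_, ?_⟩ le_rfl)
  · rw [LinearMap.finrank_range_of_inj hinj]
    simp
  · rintro _ ⟨c, rfl⟩
    exact h.isH1Circle_nodalTest hT _
  · rintro _ ⟨c, rfl⟩ hne
    obtain ⟨h1, h2⟩ := h.dirichletForm_nodalTest_nonpos hε ha hT (hD0 c) (hD1 c)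
    rw [secondVariation_eq hε]
    refine mul_neg_of_pos_of_neg hε (lt_of_le_of_ne h1 fun h3 => hne ?_)
    rw [hzero c (h2 h3), map_zero]

theorem rotationVariation_eq (u : ℝ → ℝ) : rotationVariation u = deriv u := by
  ext x
  rw [rotationVariation, deriv_comp_const_add (f := u), add_zero]

theorem mem_linearizedKernel (hε : 0 < ε) {φ : ℝ → ℝ} : φ ∈ linearizedKernel ε u ↔
    Function.Periodic φ 1 ∧ ContDiff ℝ 2 φ ∧
      ∀ x, deriv (deriv φ) x = jacobiPotential ε u x * φ x := by
  change _ ∧ _ ∧ _ ↔ _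
  refine and_congr_right fun _ => and_congr_right fun _ => forall_congr' fun x => ?_
  rw [iteratedDeriv_two_doubleWell, iteratedDeriv_succ, iteratedDeriv_one, jacobiPotential,
    sub_eq_zero, div_mul_eq_mul_div, eq_div_iff (by positivity), mul_comm]

theorem linearizedKernel_eq (h : IsNodalSolution ε a T u) (hε : 0 < ε) (ha : a ∈ Ioo (0 : ℝ) 1)
    {p : ℕ} (hp : 0 < p) (hT : 2 * p * T = 1) :
    linearizedKernel ε u = Submodule.span ℝ {deriv u} := by
  have hdper : ∀ {φ : ℝ → ℝ}, Function.Periodic φ 1 → Function.Periodic (deriv φ) 1 :=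
    fun {φ} hφ x => by
      rw [← deriv_comp_add_const (f := φ)]
      congr 1; exact funext hφ
  have hN : deriv u ∈ linearizedKernel ε u := (mem_linearizedKernel hε).2
    ⟨hdper (h.periodic hT), contDiff_infty.1 h.contDiff_deriv 2, h.deriv_deriv_deriv⟩
  refine le_antisymm (fun φ hφ => ?_) ((Submodule.span_singleton_le_iff_mem _ _).2 hN)
  -- Normalize the kernel element to vanish at the node `0`; it must then be shown to be zero.
  have hψ := sub_mem hφ (Submodule.smul_mem _ (φ 0 / deriv u 0) hN)
  have hψ0 : (φ - (φ 0 / deriv u 0) • deriv u) 0 = 0 := by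
    have := h.deriv_pos.ne'
    simp only [Pi.sub_apply, Pi.smul_apply, smul_eq_mul]
    field_simp
    ring
  suffices φ - (φ 0 / deriv u 0) • deriv u = 0 by
    rw [Submodule.mem_span_singleton]
    exact ⟨_, (sub_eq_zero.1 this).symm⟩
  generalize φ - (φ 0 / deriv u 0) • deriv u = ψ at hψ hψ0
  obtain ⟨hper, hC, hode⟩ := (mem_linearizedKernel hε).1 hψ
  have hψH : IsH1On 0 1 ψ := .of_contDiff (hC.of_le (by norm_num)) 0 1
  have hker : ∀ {η : ℝ → ℝ}, IsH1Circle η →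
      dirichletForm 0 1 (jacobiPotential ε u) ψ η = 0 := fun {η} hη => by
    rw [dirichletForm_of_solution hC hode hη.2]
    have h1 := hdper hper 0
    have h2 := hη.1 0
    rw [zero_add] at h1 h2
    rw [h1, h2, sub_self]
  -- These coefficients give the test function the nodal values of `ψ`.
  let d : ℕ → ℝ := fun j => if j < 2 * p then (-1) ^ j * ψ (j * T) else 0
  have hd0 : d 0 = 0 := by
    simp only [d]
    rw [if_pos (by omega), Nat.cast_zero, zero_mul, hψ0, mul_zero]
  have hd1 : d (2 * p) = 0 := if_neg (lt_irrefl _)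
  have hφd := h.isH1Circle_nodalTest hT d
  have hval : ∀ j ≤ 2 * p, nodalTest p T u d (j * T) = ψ (j * T) := by
    intro j hj
    rw [h.nodalTest_apply_nat_mul hp hT hd0 hd1 hj]
    rcases eq_or_lt_of_le hj with rfl | hj
    · have := hper 0
      rw [zero_add, hψ0] at this
      push_cast
      rw [hd1, mul_zero, hT, this]
    · simp only [d]
      rw [if_pos hj, ← mul_assoc, ← pow_add, ← two_mul, pow_mul, neg_one_sq, one_pow, one_mul]
  have hV := h.continuous_jacobiPotential
  -- As `ψ` is orthogonal to the test function and to itself, the difference has the same form value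
  -- as the test function. That value is at most zero, yet nonnegative since the difference vanishes
  -- at the nodes. Hence both functions vanish on `[0, 1)`.
  have hQ := dirichletForm_sub_self zero_le_one hV hψH hφd.2 (hker hφd) 1
  rw [one_smul, hker ⟨hper, hψH⟩, mul_zero, add_zero] at hQ
  have hη : IsH1On 0 1 (nodalTest p T u d - ψ) := hφd.2.sub zero_le_one hψH
  have hη0 : ∀ j ≤ 2 * p, (nodalTest p T u d - ψ) (j * T) = 0 := fun j hj => by
    rw [Pi.sub_apply, hval j hj, sub_self]
  obtain ⟨h1, h2⟩ := h.dirichletForm_nodalTest_nonpos hε ha hT hd0 hd1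
  have h3 := h.dirichletForm_nonneg_of_nodes hε hT hη hη0
  have h4 := h.eqOn_zero_of_dirichletForm_nonpos hε hT hη hη0 (hQ.trans_le h1)
  have hdz := h2 (le_antisymm h1 (h3.trans_eq hQ))
  have hz : nodalTest p T u d = 0 := Finset.sum_eq_zero fun i hi => by
    rw [hdz i (Finset.mem_Ico.1 hi).2.le, zero_smul]
  rw [hz] at h4
  ext x
  have h5 := h4 (Int.fract x) ⟨Int.fract_nonneg x, Int.fract_lt_one x⟩
  have h6 := hper.sub_int_mul_eq (x := x) ⌊x⌋
  rw [mul_one, Int.self_sub_floor] at h6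
  rw [Pi.sub_apply, Pi.zero_apply, zero_sub, neg_eq_zero, h6] at h5
  exact h5

theorem nullity_eq (h : IsNodalSolution ε a T u) (hε : 0 < ε) (ha : a ∈ Ioo (0 : ℝ) 1)
    {p : ℕ} (hp : 0 < p) (hT : 2 * p * T = 1) : nullity ε u = 1 := by
  rw [nullity, h.linearizedKernel_eq hε ha hp hT]
  refine finrank_span_singleton fun h0 => ?_
  have := h.deriv_pos
  rw [h0] at this
  exact lt_irrefl _ this

end IsNodalSolution

/-! ### The balanced energy -/

theorem contDiffAt_nodalLength {ε a : ℝ} (ha : a ∈ Ioo (0 : ℝ) 1) :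
    ContDiffAt ℝ 1 (nodalLength ε) a := by
  have h : ContDiffOn ℝ 1 (nodalLength ε) (Ioo 0 1) := by
    refine (contDiffOn_succ_iff_deriv_of_isOpen (n := 0) isOpen_Ioo).2 ⟨fun x hx =>
      (nodalLength_hasDerivAt hx).1.differentiableAt.differentiableWithinAt, by simp, ?_⟩
    rw [contDiffOn_zero]
    refine ContinuousOn.congr (f := nodalLengthDeriv ε)
      (fun x hx => (nodalLength_hasDerivAt hx).2.continuousWithinAt)
      fun x hx => (nodalLength_hasDerivAt hx).1.deriv
  exact h.contDiffAt (Ioo_mem_nhds ha.1 ha.2)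

/-- Inverse function theorem, using `nodalLengthDeriv_pos`. -/
theorem exists_amplitude_of_length {ε a : ℝ} (hε : 0 < ε) (ha : a ∈ Ioo (0 : ℝ) 1) :
    ∃ g : ℝ → ℝ, g (nodalLength ε a) = a ∧ ContDiffAt ℝ 1 g (nodalLength ε a) ∧
      ∀ᶠ l in 𝓝 (nodalLength ε a), g l ∈ Ioo (0 : ℝ) 1 ∧ nodalLength ε (g l) = l := by
  have hC := contDiffAt_nodalLength (ε := ε) ha
  have hd := (nodalLength_hasDerivAt (ε := ε) ha).1
  have hne := (nodalLengthDeriv_pos hε ha).ne'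
  have hd' : HasFDerivAt (nodalLength ε)
      (ContinuousLinearEquiv.unitsEquivAut ℝ (Units.mk0 _ hne) : ℝ →L[ℝ] ℝ) a := by
    refine hd.hasFDerivAt.congr_fderiv ?_
    ext; simp
  have hg := hC.to_localInverse hd' one_ne_zero
  have hga : hC.localInverse hd' one_ne_zero (nodalLength ε a) = a :=
    hC.localInverse_apply_image hd' one_ne_zero
  refine ⟨hC.localInverse hd' one_ne_zero, hga, hg, Eventually.and ?_ ?_⟩
  · refine hg.continuousAt.eventually_mem ?_
    rw [hga]
    exact Ioo_mem_nhds ha.1 ha.2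
  · exact (hC.hasStrictFDerivAt' hd' one_ne_zero).eventually_right_inverse

/-- The energy of the minimizer is a strictly concave `C²` function of the length. -/
theorem exists_energy_of_length {ε a : ℝ} (hε : 0 < ε) (ha : a ∈ Ioo (0 : ℝ) 1) :
    ∃ g : ℝ → ℝ,
      (∀ᶠ l in 𝓝 (nodalLength ε a), g l ∈ Ioo (0 : ℝ) 1 ∧ nodalLength ε (g l) = l) ∧
      ContDiffAt ℝ 2 (fun l => nodalEnergy ε (g l)) (nodalLength ε a) ∧
      deriv (deriv fun l => nodalEnergy ε (g l)) (nodalLength ε a) < 0 := by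
  obtain ⟨g, hga, hg, hinv⟩ := exists_amplitude_of_length hε ha
  have hdiff : ∀ᶠ l in 𝓝 (nodalLength ε a), DifferentiableAt ℝ g l :=
    (hg.eventually (by simp)).mono fun l hl => hl.differentiableAt one_ne_zero
  have hgd : ∀ᶠ l in 𝓝 (nodalLength ε a), g l ∈ Ioo (0 : ℝ) 1 ∧ DifferentiableAt ℝ g l ∧
      nodalLengthDeriv ε (g l) * deriv g l = 1 := by
    filter_upwards [hinv.eventually_nhds, hdiff] with l h1 h2
    have h3 := h1.self_of_nhds
    refine ⟨h3.1, h2, ?_⟩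
    have h4 := (nodalLength_hasDerivAt (ε := ε) h3.1).1.comp l h2.hasDerivAt
    exact h4.unique ((hasDerivAt_id l).congr_of_eventuallyEq (h1.mono fun x hx => hx.2))
  -- The factor `dT/da` cancels against `g'`. The derivative `W(g)/ε` is `C¹` because `g` is, which
  -- gives the second order of smoothness of the energy.
  have he : ∀ᶠ l in 𝓝 (nodalLength ε a),
      HasDerivAt (fun l => nodalEnergy ε (g l)) (doubleWell (g l) / ε) l := by
    filter_upwards [hgd] with l ⟨h1, h2, h3⟩
    refine ((nodalEnergy_hasDerivAt hε h1).comp l h2.hasDerivAt).congr_deriv ?_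
    rw [mul_assoc, h3, mul_one]
  have hde : deriv (fun l => nodalEnergy ε (g l)) =ᶠ[𝓝 (nodalLength ε a)]
      fun l => doubleWell (g l) / ε := he.mono fun l hl => hl.deriv
  have hW : ContDiff ℝ 1 doubleWell := by
    unfold doubleWell
    fun_prop
  refine ⟨g, hinv, ?_, ?_⟩
  · refine contDiffAt_succ_iff_hasFDerivAt (n := 1) |>.2
      ⟨fun l => ContinuousLinearMap.toSpanSingleton ℝ (doubleWell (g l) / ε), ?_, ?_⟩
    · exact ⟨_, he, fun l hl => hl.hasFDerivAt⟩
    · have h1 : ContDiffAt ℝ 1 (fun l => doubleWell (g l) / ε) (nodalLength ε a) :=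
        (hW.contDiffAt.comp _ hg).div_const ε
      exact (ContinuousLinearMap.toSpanSingletonCLE (𝕜 := ℝ) (E := ℝ)).contDiff.contDiffAt.comp _ h1
  · obtain ⟨-, h2, h3⟩ := hgd.self_of_nhds
    have h4 := ((hasDerivAt_doubleWell (g (nodalLength ε a))).comp _ h2.hasDerivAt).div_const ε
    rw [hde.deriv_eq]
    refine h4.deriv.trans_lt ?_
    rw [hga] at h3 ⊢
    have h5 := nodalLengthDeriv_pos hε ha
    have h6 : 0 < deriv g (nodalLength ε a) := by
      by_contra! h
      nlinarith
    have h7 : a ^ 3 - a < 0 := by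
      have : a * (a ^ 2 - 1) < 0 := mul_neg_of_pos_of_neg ha.1 (by nlinarith [ha.1, ha.2])
      linarith
    exact div_neg_of_neg_of_pos (mul_neg_of_neg_of_pos h7 h6) hε

/-! ### Sums along affine paths and the moving nodes -/

theorem hasDerivAt_sum_affine {e : ℝ → ℝ} {n : ℕ} {l t : ℝ} {δ : ℕ → ℝ}
    (he : ∀ i < n, DifferentiableAt ℝ e (l + t * δ i)) :
    HasDerivAt (fun t => ∑ i ∈ Finset.range n, e (l + t * δ i))
      (∑ i ∈ Finset.range n, deriv e (l + t * δ i) * δ i) t := by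
  refine HasDerivAt.fun_sum fun i hi => ?_
  have h1 : HasDerivAt (fun t => l + t * δ i) (δ i) t :=
    (((hasDerivAt_id t).mul_const (δ i)).const_add l).congr_deriv (one_mul _)
  exact (he i (Finset.mem_range.1 hi)).hasDerivAt.comp t h1

theorem eventually_affine {n : ℕ} {l : ℝ} {δ : ℕ → ℝ} {P : ℝ → Prop} (hP : ∀ᶠ x in 𝓝 l, P x) :
    ∀ᶠ t in 𝓝 (0 : ℝ), ∀ i < n, P (l + t * δ i) := by
  have : ∀ᶠ t in 𝓝 (0 : ℝ), ∀ i ∈ Finset.range n, P (l + t * δ i) := by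
    rw [Filter.eventually_all_finset]
    intro i _
    have hc : ContinuousAt (fun t => l + t * δ i) 0 := by fun_prop
    refine hc.eventually ?_
    simpa using hP
  simpa only [Finset.mem_range] using this

theorem sum_affine_contDiffAt {e : ℝ → ℝ} {n : ℕ} {l : ℝ} {δ : ℕ → ℝ}
    (he : ContDiffAt ℝ 2 e l) :
    ContDiffAt ℝ 2 (fun t => ∑ i ∈ Finset.range n, e (l + t * δ i)) 0 ∧
      deriv (fun t => ∑ i ∈ Finset.range n, e (l + t * δ i)) 0 =
        deriv e l * ∑ i ∈ Finset.range n, δ i ∧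
      iteratedDeriv 2 (fun t => ∑ i ∈ Finset.range n, e (l + t * δ i)) 0 =
        deriv (deriv e) l * ∑ i ∈ Finset.range n, δ i ^ 2 := by
  have hd : ∀ᶠ x in 𝓝 l, DifferentiableAt ℝ e x :=
    (he.eventually (by simp)).mono fun x hx => hx.differentiableAt two_ne_zero
  have hder : ∀ᶠ t in 𝓝 (0 : ℝ), HasDerivAt (fun t => ∑ i ∈ Finset.range n, e (l + t * δ i))
      (∑ i ∈ Finset.range n, deriv e (l + t * δ i) * δ i) t :=
    (eventually_affine hd).mono fun t ht => hasDerivAt_sum_affine ht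
  have hde : DifferentiableAt ℝ (deriv e) l := by
    have h1 : ContDiffAt ℝ 1 (fderiv ℝ e) l := he.fderiv_right (by norm_num)
    have h2 := (h1.differentiableAt one_ne_zero).clm_apply (differentiableAt_const (1 : ℝ))
    simpa only [fderiv_apply_one_eq_deriv] using h2
  refine ⟨ContDiffAt.sum fun i _ => ?_, ?_, ?_⟩
  · refine ContDiffAt.comp (g := e) (f := fun t => l + t * δ i) 0 ?_ (by fun_prop)
    simpa using he
  · rw [hder.self_of_nhds.deriv, Finset.mul_sum]
    simp
  · rw [iteratedDeriv_succ, iteratedDeriv_one,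
      EventuallyEq.deriv_eq (hder.mono fun t ht => ht.deriv), Finset.mul_sum]
    have hterm : ∀ i ∈ Finset.range n, HasDerivAt (fun t => deriv e (l + t * δ i) * δ i)
        (deriv (deriv e) l * δ i ^ 2) 0 := fun i _ => by
      have h1 : HasDerivAt (fun t => l + t * δ i) (δ i) 0 :=
        (((hasDerivAt_id (0 : ℝ)).mul_const (δ i)).const_add l).congr_deriv (one_mul _)
      have h2 : HasDerivAt (deriv e) (deriv (deriv e) l) (l + 0 * δ i) := by
        rw [zero_mul, add_zero]
        exact hde.hasDerivAt
      have h3 : HasDerivAt (fun t => deriv e (l + t * δ i)) (deriv (deriv e) l * δ i) 0 :=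
        h2.comp_of_eq 0 h1 rfl
      have h4 := h3.mul_const (δ i)
      rwa [mul_assoc, ← pow_two] at h4
    exact (HasDerivAt.fun_sum hterm).deriv

theorem nodes_succ (p : ℕ) (f : ZMod (2 * p) → ℝ) (t : ℝ) (i : ℕ) :
    nodes p f t (i + 1) = nodes p f t i + (1 / (2 * (p : ℝ)) +
      t * (f ((i + 1 : ℕ) : ZMod (2 * p)) - f (i : ZMod (2 * p)))) := by
  unfold nodes
  push_cast
  ring

theorem nodes_last {p : ℕ} (hp : 0 < p) (f : ZMod (2 * p) → ℝ) (t : ℝ) :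
    nodes p f t (2 * p) = nodes p f t 0 + 1 := by
  have hp' : (0 : ℝ) < 2 * p := by positivity
  unfold nodes
  rw [ZMod.natCast_self, Nat.cast_zero, Nat.cast_zero]
  push_cast
  field_simp
  ring

/-- A function on the nodes is constant if its increments vanish. -/
theorem exists_const_of_increments {p : ℕ} (hp : 0 < p) {f : ZMod (2 * p) → ℝ}
    (h : ∀ i < 2 * p, f ((i + 1 : ℕ) : ZMod (2 * p)) - f (i : ZMod (2 * p)) = 0) :
    ∃ c, ∀ i, f i = c := by
  have : NeZero (2 * p) := ⟨by omega⟩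
  have h1 : ∀ i < 2 * p, f (i : ZMod (2 * p)) = f 0 := by
    intro i
    induction i with
    | zero => simp
    | succ i ih =>
      intro hi
      linarith [h i (by omega), ih (by omega)]
  refine ⟨f 0, fun i => ?_⟩
  rw [← ZMod.natCast_zmod_val i]
  exact h1 _ (ZMod.val_lt i)

/-- The increments of `f` around the circle telescope to zero, which kills the first derivative; the
sum of their squares vanishes only for constant `f`. -/
theorem balancedEnergy_nodes {ε a : ℝ} (hε : 0 < ε) (ha : a ∈ Ioo (0 : ℝ) 1) {p : ℕ}
    (hp : 0 < p) (hl : nodalLength ε a = 1 / (2 * (p : ℝ))) (f : ZMod (2 * p) → ℝ) :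
    (∀ᶠ t in 𝓝 (0 : ℝ), ∃ U, IsBrokenPhaseTransition ε p (nodes p f t) U) ∧
      ContDiffAt ℝ 2 (fun t => balancedEnergy ε p (nodes p f t)) 0 ∧
      deriv (fun t => balancedEnergy ε p (nodes p f t)) 0 = 0 ∧
      ((∃ c : ℝ, ∀ i, f i = c) →
        iteratedDeriv 2 (fun t => balancedEnergy ε p (nodes p f t)) 0 = 0) ∧
      ((¬ ∃ c : ℝ, ∀ i, f i = c) →
        iteratedDeriv 2 (fun t => balancedEnergy ε p (nodes p f t)) 0 < 0) := by
  obtain ⟨g, hinv, hC, hneg⟩ := exists_energy_of_length hε ha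
  rw [hl] at hinv hC hneg
  let δ : ℕ → ℝ := fun i => f ((i + 1 : ℕ) : ZMod (2 * p)) - f (i : ZMod (2 * p))
  have hev : ∀ᶠ t in 𝓝 (0 : ℝ), (∃ U, IsBrokenPhaseTransition ε p (nodes p f t) U) ∧
      balancedEnergy ε p (nodes p f t) =
        ∑ i ∈ Finset.range (2 * p), nodalEnergy ε (g (1 / (2 * (p : ℝ)) + t * δ i)) := by
    filter_upwards [eventually_affine (n := 2 * p) (δ := δ) hinv] with t ht
    refine balancedEnergy_eq_sum hε hp (nodes_last hp f t) (fun i hi => (ht i hi).1)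
      fun i hi => ?_
    rw [(ht i hi).2, nodes_succ]
  have heq := hev.mono fun t ht => ht.2
  obtain ⟨h1, h2, h3⟩ := sum_affine_contDiffAt (n := 2 * p) (δ := δ) hC
  refine ⟨hev.mono fun t ht => ht.1, h1.congr_of_eventuallyEq heq, ?_, fun ⟨c, hc⟩ => ?_,
    fun hnc => ?_⟩
  · rw [EventuallyEq.deriv_eq heq, h2,
      Finset.sum_range_sub (fun i : ℕ => f (i : ZMod (2 * p))), ZMod.natCast_self, Nat.cast_zero,
      sub_self, mul_zero]
  · rw [EventuallyEq.iteratedDeriv_eq 2 heq, h3]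
    simp [δ, hc]
  · rw [EventuallyEq.iteratedDeriv_eq 2 heq, h3]
    refine mul_neg_of_neg_of_pos hneg ?_
    obtain ⟨i, hi, hne⟩ : ∃ i < 2 * p, δ i ≠ 0 := by
      by_contra! hcon
      exact hnc (exists_const_of_increments hp hcon)
    exact Finset.sum_pos' (fun _ _ => sq_nonneg _) ⟨i, Finset.mem_range.2 hi, by positivity⟩

end AllenCahn

/-! ### The main theorem -/

theorem mainTheorem8 (p : ℕ) (hp : 0 < p) :
    ∃ εp : ℝ, 0 < εp ∧ ∀ ε : ℝ, 0 < ε → ε < εp →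
      -- the positive Dirichlet minimizer on `[0, 1/(2p)]` exists and is unique
      (∃ v, AllenCahn.IsPositiveMinimizer ε 0 (1 / (2 * (p : ℝ))) v ∧
        ∀ w, AllenCahn.IsPositiveMinimizer ε 0 (1 / (2 * (p : ℝ))) w →
          Set.EqOn w v (Set.Icc 0 (1 / (2 * (p : ℝ))))) ∧
      -- and for `u = u_{ε,2p}`:
      ∀ v, AllenCahn.IsPositiveMinimizer ε 0 (1 / (2 * (p : ℝ))) v →
        ∀ u : ℝ → ℝ, u = AllenCahn.dihedralExtension p v →
          AllenCahn.IsSolution ε u ∧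
          AllenCahn.morseIndex ε u = ((2 * p - 1 : ℕ) : ℕ∞) ∧
          AllenCahn.nullity ε u = 1 ∧
          AllenCahn.linearizedKernel ε u =
            Submodule.span ℝ {AllenCahn.rotationVariation u} ∧
          -- every variation of the nodes
          ∀ f : ZMod (2 * p) → ℝ,
            AllenCahn.IsBrokenPhaseTransition ε p (AllenCahn.nodes p f 0) u ∧
            (∀ᶠ t in nhds (0 : ℝ),
              ∃ U, AllenCahn.IsBrokenPhaseTransition ε p (AllenCahn.nodes p f t) U) ∧
            ContDiffAt ℝ 2
              (fun t => AllenCahn.balancedEnergy ε p (AllenCahn.nodes p f t)) 0 ∧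
            deriv (fun t => AllenCahn.balancedEnergy ε p (AllenCahn.nodes p f t)) 0 = 0 ∧
            ((∃ c : ℝ, ∀ i, f i = c) →
              iteratedDeriv 2
                (fun t => AllenCahn.balancedEnergy ε p (AllenCahn.nodes p f t)) 0 = 0) ∧
            ((¬ ∃ c : ℝ, ∀ i, f i = c) →
              iteratedDeriv 2
                (fun t => AllenCahn.balancedEnergy ε p (AllenCahn.nodes p f t)) 0 < 0) := by
  have hp' : (0 : ℝ) < p := by exact_mod_cast hp
  have hπ := Real.pi_pos
  -- This threshold is exactly the condition `2πε < 1/(2p)` of `exists_nodalLength_eq`.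
  refine ⟨1 / (4 * p * Real.pi), by positivity, fun ε hε hlt => ?_⟩
  have hlen : 2 * Real.pi * ε < 1 / (2 * (p : ℝ)) := by
    rw [lt_div_iff₀ (by positivity)] at hlt ⊢
    linarith
  obtain ⟨a, ha, hl⟩ := AllenCahn.exists_nodalLength_eq hε hlen
  have h := AllenCahn.isNodalSolution_nodalSolution hε ha
  generalize AllenCahn.nodalSolution ε a = u₀ at h
  have hT : 2 * (p : ℝ) * AllenCahn.nodalLength ε a = 1 := by
    rw [hl]
    field_simp
  have hmin := h.isPositiveMinimizer_translate hε 0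
  simp only [sub_zero, zero_add] at hmin
  refine ⟨⟨u₀, hl ▸ hmin, fun w hw => ?_⟩, fun v hv u hu => ?_⟩
  · rw [← hl] at hw ⊢
    exact h.eqOn_of_isPositiveMinimizer hε hw
  · rw [h.dihedralExtension_eq hp hl (h.eqOn_of_isPositiveMinimizer hε (hl ▸ hv))] at hu
    subst hu
    refine ⟨h.isSolution hε hT, le_antisymm (h.morseIndex_le hε hT) (h.le_morseIndex hε ha hp hT),
      h.nullity_eq hε ha hp hT, ?_, fun f => ⟨h.isBrokenPhaseTransition hε hT fun i => ?_,
        AllenCahn.balancedEnergy_nodes hε ha hp hl f⟩⟩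
    · rw [AllenCahn.IsNodalSolution.rotationVariation_eq]
      exact h.linearizedKernel_eq hε ha hp hT
    · rw [AllenCahn.nodes, hl]
      ring
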